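/- Let $G=(V,E)$ be a finite simple graph with $V\neq\emptyset$ (say $V=\{1,\dots,m\}$, $m\ge 1$), and let $\overline{E}$ be the set consisting of its edges together with all self-loops $(i,i)$, $i\in V$. Let $\mathcal{C}_G\subset\mathbb{R}^{\overline{E}}$ be the open convex cone of all partial symmetric matrices $(t_{ij})_{(i,j)\in \overline{E}}$ that can be extended to a positive definite matrix, and let $\partial\mathcal{C}_G=\overline{\mathcal{C}_G}\setminus\mathcal{C}_G$ be its boundary. Let $\mathbb{K}$ be $\mathbb{R}$ or $\mathbb{C}$. A defining polynomial $H_G\in\mathbb{K}[t_{ij}:(i,j)\in\overline{E}]$ of the Zariski closure of $\partial\mathcal{C}_G$ is a nonzero polynomial that generates the ideal of all polynomials over $\mathbb{K}$ vanishing on $\partial\mathcal{C}_G$; it is unique up to a nonzero constant factor. Let $G^*$ be the suspension graph of $G$, obtained by adding one new vertex $0$ joined to every vertex of $G$, and write $u_{ij}$ for the coordinates attached to the edges and self-loops of $G^*$. For a polynomial $p(t_{ij})$, let $N(p)\in\mathbb{K}[u_{ij}]$ be the numerator, in lowest terms (defined up to a nonzero constant factor), of the Laurent polynomial obtained from $p$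 by the substitution $$t_{ij}\;=\;u_{ij}-\frac{u_{0i}u_{0j}}{u_{00}}\qquad\text{for all edges and self-loops } (i,j) \text{ of } G.$$ Then $H_G$ exists (the Zariski closure of $\partial\mathcal{C}_G$ is a hypersurface), and the following hold. 1. $N(H_G)$ is a defining polynomial of the Zariski closure of $\partial\mathcal{C}_{G^*}$; that is, $H_{G^*}=N(H_G)$ up to a nonzero constant factor. 2. The same holds factor by factor: if $p$ is an irreducible factor of $H_G$, then $N(p)$ is an irreducible factor of $H_{G^*}$, and every irreducible factor of $H_{G^*}$ equals, up to a nonzero constant factor, $N(p)$ for an irreducible factor $p$ of $H_G$ that is unique up to a nonzero constant factor. -/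

import Mathlib

noncomputable section

namespace GaussianGraph

/-- The positions `(i, j)` with `i ≤ j` of a partial symmetric matrix on `G`: the edges of `G`
together with all self-loops, as unordered pairs. -/
abbrev Edge {V : Type*} (G : SimpleGraph V) : Type _ :=
  {e : Sym2 V // e.IsDiag ∨ e ∈ G.edgeSet}

/-- The cone of sufficient statistics of the Gaussian graphical model on `G`: the partial matrices
with entries in the positions of `G` that extend to a positive definite matrix. -/
def sufficientCone {V : Type*} (G : SimpleGraph V) : Set (Edge G → ℝ) :=
  {T | ∃ S : Matrix V V ℝ, S.PosDef ∧
    ∀ (i j : V) (h : s(i, j).IsDiag ∨ s(i, j) ∈ G.edgeSet), S i j = T ⟨s(i, j), h⟩}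

/-- The boundary of the cone of sufficient statistics, i.e. its closure minus the (open) cone. -/
def coneBoundary {V : Type*} (G : SimpleGraph V) : Set (Edge G → ℝ) :=
  closure (sufficientCone G) \ sufficientCone G

/-- `H` is a defining polynomial, over `𝕜 = ℝ` or `𝕜 = ℂ`, of the Zariski closure of the boundary of
the cone of sufficient statistics: that Zariski closure is the hypersurface `{H = 0}`, and the ideal
of all polynomials vanishing on it is generated by `H`. -/
def IsDefiningPolynomial (𝕜 : Type*) [RCLike 𝕜] {V : Type*} (G : SimpleGraph V)
    (H : MvPolynomial (Edge G) 𝕜) : Prop :=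
  H ≠ 0 ∧
    MvPolynomial.vanishingIdeal 𝕜
        ((fun (T : Edge G → ℝ) (e : Edge G) => (T e : 𝕜)) '' coneBoundary G) =
      Ideal.span {H}

/-- The suspension graph: one additional vertex `none` (the vertex `0`), joined to all vertices. -/
def suspension {V : Type*} (G : SimpleGraph V) : SimpleGraph (Option V) where
  Adj
    | none, none => False
    | none, some _ => True
    | some _, none => True
    | some i, some j => G.Adj i j
  symm := ⟨by
    rintro (_ | i) (_ | j) h
    · exact h
    · trivial
    · trivial
    · exact SimpleGraph.Adj.symm h⟩
  loopless := ⟨by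
    rintro (_ | i) h
    · exact h
    · exact G.loopless.irrefl i h⟩

/-- The position `(0, 0)` of the suspension graph. -/
def apexLoop {V : Type*} (G : SimpleGraph V) : Edge (suspension G) :=
  ⟨s(none, none), Or.inl rfl⟩

/-- The position `(0, i)` of the suspension graph. -/
def apexEdge {V : Type*} (G : SimpleGraph V) (i : V) : Edge (suspension G) :=
  ⟨s(none, some i), Or.inr trivial⟩

/-- The position `(i, j)` of `G`, as a position of the suspension graph. -/
def baseEdge {V : Type*} (G : SimpleGraph V) (e : Edge G) : Edge (suspension G) :=
  ⟨e.1.map some, e.2.imp Sym2.IsDiag.map (by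
    generalize e.1 = z
    induction z with
    | _ i j => exact id)⟩

/-- The function field `𝕜(u_e : e a position of the suspension graph)`, in which the Laurent
polynomials live. -/
abbrev SuspensionField (𝕜 : Type*) [RCLike 𝕜] {V : Type*} (G : SimpleGraph V) : Type _ :=
  FractionRing (MvPolynomial (Edge (suspension G)) 𝕜)

/-- The coordinate `u_e` in the function field. -/
def coord (𝕜 : Type*) [RCLike 𝕜] {V : Type*} (G : SimpleGraph V) (e : Edge (suspension G)) :
    SuspensionField 𝕜 G :=
  algebraMap (MvPolynomial (Edge (suspension G)) 𝕜) (SuspensionField 𝕜 G) (MvPolynomial.X e)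

/-- The substitution `t_ij = u_ij - u_0i u_0j / u_00`. -/
def schurSubst (𝕜 : Type*) [RCLike 𝕜] {V : Type*} (G : SimpleGraph V) :
    MvPolynomial (Edge G) 𝕜 →ₐ[𝕜] SuspensionField 𝕜 G :=
  MvPolynomial.aeval fun e =>
    coord 𝕜 G (baseEdge G e) -
      (e.1.map fun i => coord 𝕜 G (apexEdge G i)).mul / coord 𝕜 G (apexLoop G)

/-- The numerator (in lowest terms, hence unique up to a nonzero constant) of the Laurent polynomial
obtained from `p` by the substitution `t_ij = u_ij - u_0i u_0j / u_00`. -/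
def schurNumerator (𝕜 : Type*) [RCLike 𝕜] {V : Type*} (G : SimpleGraph V)
    (p : MvPolynomial (Edge G) 𝕜) : MvPolynomial (Edge (suspension G)) 𝕜 :=
  IsFractionRing.num (MvPolynomial (Edge (suspension G)) 𝕜) (schurSubst 𝕜 G p)

end GaussianGraph

end

/-! Existence. By duality, a boundary point is the partial matrix of some psd `A * Aᵀ` annihilated
by a psd `K = B * Bᵀ` of trace one supported on `G`. Such pairs form a real algebraic set, on which
`K A = 0` yields the relation `∑ K_ij d(A * Aᵀ)_ij = 0` with some coefficient nonzero. In
characteristic zero this makes the entries algebraically dependent on each component, so the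
boundary is not Zariski dense (`exists_ne_zero_forall_mem_coneBoundary`). Moreover every line in the
direction of the identity that passes near a boundary point meets the boundary nearby; this excludes
further common zeros of codimension two, so the vanishing ideal is principal
(`exists_vanishingIdeal_eq_span_singleton`).

Suspension. Where `u_00 > 0`, the apex row and the Schur complement are coordinates in which the
boundary for the suspension is the boundary for `G` times a free apex row
(`mem_coneBoundary_suspension_iff`); boundary points with `u_00 = 0` are limits of these.
Algebraically, the substitution is an automorphism of the polynomial ring with `u_00` inverted
(`schurEquiv`). A polynomial in those coordinates vanishes on the product iff all its coefficients
in the apex variables are multiples of `H`. Since numerators are not divisible by `u_00`,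
divisibility and primality can be tested after inverting `u_00`, which gives both claims. -/

section AlgebraicElimination

/-! ### Differentials and algebraic dependence. -/

open KaehlerDifferential TensorProduct

/-- In characteristic zero, the differentials of algebraically independent elements of a finitely
generated field extension are linearly independent. -/
theorem AlgebraicIndependent.linearIndependent_kaehlerDifferential {k F σ : Type*} [Field k]
    [CharZero k] [Field F] [Algebra k F] [Algebra.EssFiniteType k F] {t : σ → F}
    (h : AlgebraicIndependent k t) :
    LinearIndependent F fun i => KaehlerDifferential.D k F (t i) := by
  let : Algebra (MvPolynomial σ k) F := (MvPolynomial.aeval t : _ →ₐ[k] F).toRingHom.toAlgebra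
  have : IsScalarTower k (MvPolynomial σ k) F :=
    IsScalarTower.of_algebraMap_eq fun x => ((MvPolynomial.aeval t).commutes x).symm
  have : FaithfulSMul (MvPolynomial σ k) F := (faithfulSMul_iff_algebraMap_injective _ _).2 h
  let := FractionRing.liftAlgebra (MvPolynomial σ k) F
  have : IsScalarTower k (FractionRing (MvPolynomial σ k)) F := inferInstance
  have : Algebra.EssFiniteType (FractionRing (MvPolynomial σ k)) F :=
    Algebra.EssFiniteType.of_comp k _ F
  have : CharZero (FractionRing (MvPolynomial σ k)) :=
    charZero_of_injective_algebraMap (FaithfulSMul.algebraMap_injective k _)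
  have : Algebra.FormallySmooth (MvPolynomial σ k) (FractionRing (MvPolynomial σ k)) :=
    .of_isLocalization (nonZeroDivisors _)
  have : Algebra.FormallySmooth (MvPolynomial σ k) F :=
    .comp _ (FractionRing (MvPolynomial σ k)) _
  -- The kernel is the image of the first cotangent homology of `F` over the polynomial ring, which
  -- vanishes by formal smoothness.
  have hinj : Function.Injective (mapBaseChange k (MvPolynomial σ k) F) := by
    rw [injective_iff_map_eq_zero]
    intro x hx
    obtain ⟨y, rfl⟩ := (Algebra.H1Cotangent.exact_δ_mapBaseChange k (MvPolynomial σ k) F x).mp hx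
    rw [Subsingleton.elim y 0, map_zero]
  have hb := (((mvPolynomialBasis k σ).baseChange F).linearIndependent).map'
    (mapBaseChange k (MvPolynomial σ k) F) (LinearMap.ker_eq_bot.2 hinj)
  have he : (fun i => KaehlerDifferential.D k F (t i)) =
      mapBaseChange k (MvPolynomial σ k) F ∘ (mvPolynomialBasis k σ).baseChange F := by
    ext i
    have : algebraMap (MvPolynomial σ k) F (MvPolynomial.X i) = t i := MvPolynomial.aeval_X t i
    simp [this]
  rw [he]
  exact hb

/-- An algebraic form of Sard's theorem: if the differentials of the functions `t` satisfy a
nontrivial linear relation at every generic point of `Z`, then the image of `Z` under `t` lies in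
a hypersurface. -/
theorem MvPolynomial.exists_ne_zero_aeval_eq_zero_of_kaehlerDifferential {k : Type*} {τ : Type*}
    {σ : Type*} [Field k] [CharZero k] [Finite τ] [Fintype σ] (Z : Set (τ → k))
    (t c : σ → MvPolynomial τ k)
    (hZ : ∀ (P : Ideal (MvPolynomial τ k)) [P.IsPrime],
      let F := FractionRing (MvPolynomial τ k ⧸ P)
      vanishingIdeal k Z ≤ P → ∑ e, algebraMap (MvPolynomial τ k) F (c e) •
        KaehlerDifferential.D k F (algebraMap (MvPolynomial τ k) F (t e)) = 0 ∧
        ∃ e, algebraMap (MvPolynomial τ k) F (c e) ≠ 0) :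
    ∃ f : MvPolynomial σ k, f ≠ 0 ∧ ∀ z ∈ Z, aeval (fun e => aeval z (t e)) f = 0 := by
  -- On each component the relation between differentials forbids algebraic independence. The
  -- product of the resulting equations over the finitely many minimal primes lies in the radical.
  have key : ∀ P ∈ (vanishingIdeal k Z).minimalPrimes,
      ∃ f : MvPolynomial σ k, f ≠ 0 ∧ aeval t f ∈ P := by
    intro P hP
    have : P.IsPrime := hP.1.1
    obtain ⟨h0, e, he⟩ := hZ P hP.1.2
    by_contra! hcon
    set F := FractionRing (MvPolynomial τ k ⧸ P)
    have : Algebra.EssFiniteType (MvPolynomial τ k ⧸ P) F :=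
      .of_isLocalization _ (nonZeroDivisors _)
    have : Algebra.EssFiniteType k F := .comp k (MvPolynomial τ k ⧸ P) F
    have halg : AlgebraicIndependent k fun e => algebraMap (MvPolynomial τ k) F (t e) := by
      rw [algebraicIndependent_iff]
      intro f hf
      by_contra hf0
      refine hcon f hf0 ?_
      have h1 : aeval (fun e => algebraMap (MvPolynomial τ k) F (t e)) f =
          algebraMap (MvPolynomial τ k) F (aeval t f) := by
        exact aeval_algebraMap_apply F t f
      rw [h1, IsScalarTower.algebraMap_apply (MvPolynomial τ k) (MvPolynomial τ k ⧸ P) F] at hf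
      exact Ideal.Quotient.eq_zero_iff_mem.1
        ((map_eq_zero_iff _ (IsFractionRing.injective (MvPolynomial τ k ⧸ P) F)).1 hf)
    exact he (Fintype.linearIndependent_iff.1 halg.linearIndependent_kaehlerDifferential _ h0 e)
  choose! f hf0 hfP using key
  have hfin := Ideal.finite_minimalPrimes_of_isNoetherianRing _ (vanishingIdeal k Z)
  refine ⟨∏ P ∈ hfin.toFinset, f P, Finset.prod_ne_zero_iff.2 fun P hP => hf0 P (by simpa using hP),
    fun z hz => ?_⟩
  have hmem : aeval t (∏ P ∈ hfin.toFinset, f P) ∈ (vanishingIdeal k Z).radical := by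
    rw [← Ideal.sInf_minimalPrimes, Ideal.mem_sInf]
    intro P hP
    rw [map_prod]
    exact Ideal.mem_of_dvd _ (Finset.dvd_prod_of_mem _ (by simpa using hP)) (hfP P hP)
  obtain ⟨n, hn⟩ := hmem
  have := hn z hz
  rw [map_pow] at this
  rw [← IsNilpotent.eq_zero ⟨n, this⟩, ← AlgHom.comp_apply, comp_aeval]

end AlgebraicElimination

/-! ### Convex geometry of the cone of sufficient statistics. -/

noncomputable section

namespace GaussianGraph

open Matrix Topology Filter

section Cone

variable {V : Type*} {G : SimpleGraph V}

/-- The symmetric matrix `S` extends the partial matrix `T`. -/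
def Extends (T : Edge G → ℝ) (S : Matrix V V ℝ) : Prop :=
  ∀ (i j : V) (h : s(i, j).IsDiag ∨ s(i, j) ∈ G.edgeSet), S i j = T ⟨s(i, j), h⟩

/-- The position `(i, i)`. -/
def loop (G : SimpleGraph V) (i : V) : Edge G := ⟨s(i, i), Or.inl rfl⟩

/-- The partial matrix of the symmetric part of a matrix. -/
def symmRestrict (G : SimpleGraph V) : Matrix V V ℝ →ₗ[ℝ] (Edge G → ℝ) where
  toFun S e := Sym2.lift ⟨fun i j => (S i j + S j i) / 2, fun i j => by simp only [add_comm]⟩ e.1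
  map_add' S S' := by
    ext ⟨e, he⟩
    induction e with
    | _ i j => simp; ring
  map_smul' a S := by
    ext ⟨e, he⟩
    induction e with
    | _ i j => simp; ring

theorem symmRestrict_mk (S : Matrix V V ℝ) (i j : V) (h) :
    symmRestrict G S ⟨s(i, j), h⟩ = (S i j + S j i) / 2 := rfl

theorem Extends.symmRestrict_eq {T : Edge G → ℝ} {S : Matrix V V ℝ} (h : Extends T S) :
    symmRestrict G S = T := by
  ext ⟨e, he⟩
  induction e with
  | _ i j =>
    have h2 : S j i = T ⟨s(i, j), he⟩ := by
      rw [h j i (by rwa [Sym2.eq_swap])]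
      congr 2
      exact Sym2.eq_swap
    rw [symmRestrict_mk, h i j he, h2]
    ring

theorem extends_symmRestrict {S : Matrix V V ℝ} (h : S.IsHermitian) :
    Extends (symmRestrict G S) S := by
  intro i j he
  have := h.apply i j
  rw [star_trivial] at this
  rw [symmRestrict_mk, this]
  ring

theorem mem_sufficientCone_iff {T : Edge G → ℝ} :
    T ∈ sufficientCone G ↔ ∃ S : Matrix V V ℝ, S.PosDef ∧ symmRestrict G S = T :=
  ⟨fun ⟨S, hS, h⟩ => ⟨S, hS, Extends.symmRestrict_eq h⟩,
    fun ⟨S, hS, h⟩ => ⟨S, hS, h ▸ extends_symmRestrict hS.1⟩⟩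

theorem convex_sufficientCone : Convex ℝ (sufficientCone G) := by
  rintro x hx y hy a b ha hb hab
  rw [mem_sufficientCone_iff] at hx hy ⊢
  obtain ⟨S, hS, rfl⟩ := hx
  obtain ⟨S', hS', rfl⟩ := hy
  refine ⟨a • S + b • S', ?_, by simp⟩
  rcases ha.eq_or_lt with rfl | ha
  · obtain rfl : b = 1 := by linarith
    simpa using hS'
  · exact (hS.smul ha).add_posSemidef (hS'.posSemidef.smul hb)

theorem smul_mem_sufficientCone {x : Edge G → ℝ} (hx : x ∈ sufficientCone G) {a : ℝ} (ha : 0 < a) :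
    a • x ∈ sufficientCone G := by
  rw [mem_sufficientCone_iff] at hx ⊢
  obtain ⟨S, hS, rfl⟩ := hx
  exact ⟨a • S, hS.smul ha, by simp⟩

open Classical in
/-- The partial identity matrix. -/
def partialOne (G : SimpleGraph V) : Edge G → ℝ := symmRestrict G 1

theorem symmRestrict_one [DecidableEq V] : symmRestrict G 1 = partialOne G := by
  unfold partialOne
  congr!

theorem partialOne_mem : partialOne G ∈ sufficientCone G := by
  classical
  rw [mem_sufficientCone_iff]
  exact ⟨1, .one, symmRestrict_one⟩

variable [Fintype V]

theorem PosSemidef.quadratic_nonneg {S : Matrix V V ℝ} (h : S.PosSemidef) (i j : V) (a b : ℝ) :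
    0 ≤ a ^ 2 * S i i + 2 * a * b * S i j + b ^ 2 * S j j := by
  classical
  have h1 := h.dotProduct_mulVec_nonneg (a • Pi.single i 1 + b • Pi.single j 1)
  have h2 := h.1.apply i j
  simp only [star_trivial] at h1 h2
  simp [Matrix.mulVec_add, Matrix.mulVec_smul, add_dotProduct, h2] at h1
  linarith

/-- Compactness: all diagonal entries are prescribed, so those of the approximating extensions are
bounded, and positivity bounds the remaining entries by them. A subsequence of the extensions
therefore converges. -/
theorem exists_posSemidef_of_mem_closure {T : Edge G → ℝ} (hT : T ∈ closure (sufficientCone G)) :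
    ∃ S : Matrix V V ℝ, S.PosSemidef ∧ symmRestrict G S = T := by
  obtain ⟨u, hu, hlim⟩ := mem_closure_iff_seq_limit.1 hT
  choose S hS hSu using hu
  have hdiag : ∀ i : V, ∃ B, ∀ n, S n i i ≤ B := by
    intro i
    obtain ⟨B, hB⟩ := ((tendsto_pi_nhds.1 hlim) (loop G i)).bddAbove_range
    exact ⟨B, fun n => by rw [hSu n i i (Or.inl rfl)]; exact hB ⟨n, rfl⟩⟩
  choose B hB using hdiag
  have hmem : ∀ n, (S n : V → V → ℝ) ∈
      Set.univ.pi fun i => Set.univ.pi fun j => Set.Icc (-(B i + B j)) (B i + B j) := by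
    intro n i _ j _
    have h1 := PosSemidef.quadratic_nonneg (hS n).posSemidef i j 1 1
    have h2 := PosSemidef.quadratic_nonneg (hS n).posSemidef i j 1 (-1)
    have h3 := hB i n
    have h4 := hB j n
    have h5 := PosSemidef.quadratic_nonneg (hS n).posSemidef i j 1 0
    have h6 := PosSemidef.quadratic_nonneg (hS n).posSemidef i j 0 1
    constructor <;> linarith
  obtain ⟨S₀, -, φ, hφ, hφlim⟩ := (isCompact_univ_pi fun i => isCompact_univ_pi fun j =>
    isCompact_Icc).tendsto_subseq hmem
  have hent : ∀ i j, Tendsto (fun n => S (φ n) i j) atTop (𝓝 (S₀ i j)) := fun i j =>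
    tendsto_pi_nhds.1 (tendsto_pi_nhds.1 hφlim i) j
  refine ⟨Matrix.of S₀, .of_dotProduct_mulVec_nonneg ?_ fun x => ?_, Extends.symmRestrict_eq ?_⟩
  · ext i j
    refine tendsto_nhds_unique (hent j i) ((hent i j).congr fun n => Eq.symm ?_)
    exact (hS _).1.apply i j
  · refine ge_of_tendsto' (f := fun n => star x ⬝ᵥ (S (φ n)) *ᵥ x) (x := atTop) ?_
      fun n => (hS _).posSemidef.dotProduct_mulVec_nonneg x
    simp only [dotProduct, mulVec, of_apply]
    exact tendsto_finsetSum _ fun i _ => tendsto_const_nhds.mul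
      (tendsto_finsetSum _ fun j _ => (hent i j).mul tendsto_const_nhds)
  · intro i j h
    refine tendsto_nhds_unique (hent i j) ?_
    simp only [fun n => hSu (φ n) i j h]
    exact (tendsto_pi_nhds.1 hlim _).comp hφ.tendsto_atTop

theorem add_smul_partialOne_mem {x : Edge G → ℝ} (hx : x ∈ closure (sufficientCone G)) {ε : ℝ}
    (hε : 0 < ε) : x + ε • partialOne G ∈ sufficientCone G := by
  classical
  obtain ⟨S, hS, rfl⟩ := exists_posSemidef_of_mem_closure hx
  rw [mem_sufficientCone_iff]
  exact ⟨S + ε • 1, Matrix.PosDef.posSemidef_add hS (Matrix.PosDef.one.smul hε), by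
    rw [map_add, map_smul, symmRestrict_one]⟩

/-- Keep the entries of one positive definite extension outside the positions of `G` and overwrite
the others by `T`. Positivity on the compact unit sphere survives small changes of `T`. -/
theorem isOpen_sufficientCone : IsOpen (sufficientCone G) := by
  classical
  rw [isOpen_iff_mem_nhds]
  intro T hT
  obtain ⟨S, hS, rfl⟩ := mem_sufficientCone_iff.1 hT
  let fill : (Edge G → ℝ) → Matrix V V ℝ := fun T =>
    Matrix.of fun i j => if h : s(i, j).IsDiag ∨ s(i, j) ∈ G.edgeSet then T ⟨s(i, j), h⟩ else S i j
  have hfillS : fill (symmRestrict G S) = S := by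
    ext i j
    simp only [fill, of_apply]
    split_ifs with h
    · exact (extends_symmRestrict hS.1 i j h).symm
    · rfl
  have hsymm : ∀ T, (fill T).IsHermitian := by
    intro T
    ext i j
    simp only [fill, conjTranspose_apply, of_apply, star_trivial]
    have := hS.1.apply i j
    rw [star_trivial] at this
    simp only [this, Sym2.eq_swap (a := j) (b := i)]
  have hcont : Continuous fun p : (Edge G → ℝ) × (V → ℝ) => p.2 ⬝ᵥ (fill p.1) *ᵥ p.2 := by
    have : Continuous fill := by
      refine continuous_matrix fun i j => ?_
      simp only [fill, of_apply]
      split_ifs with h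
      · exact continuous_apply _
      · exact continuous_const
    fun_prop
  have hev : ∀ᶠ T in 𝓝 (symmRestrict G S), ∀ x ∈ Metric.sphere (0 : V → ℝ) 1,
      0 < x ⬝ᵥ (fill T) *ᵥ x := by
    refine (isCompact_sphere _ _).eventually_forall_of_forall_eventually fun x hx => ?_
    refine (hcont.tendsto _).eventually_const_lt ?_
    rw [hfillS]
    refine hS.dotProduct_mulVec_pos (x := x) ?_
    rintro rfl
    simp at hx
  filter_upwards [hev] with T hT
  refine mem_sufficientCone_iff.2 ⟨fill T, .of_dotProduct_mulVec_pos (hsymm T) fun x hx => ?_,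
    Extends.symmRestrict_eq fun i j h => dif_pos h⟩
  have h1 := hT (‖x‖⁻¹ • x) (by simp [norm_smul, hx])
  simp only [mulVec_smul, dotProduct_smul, smul_dotProduct, smul_eq_mul] at h1
  have h2 : 0 < ‖x‖⁻¹ := inv_pos.2 (norm_pos_iff.2 hx)
  simpa [h2] using h1

theorem exists_mem_coneBoundary {x y : Edge G → ℝ} (hx : x ∈ closure (sufficientCone G))
    (hy : y ∉ closure (sufficientCone G)) : ∃ z ∈ segment ℝ x y, z ∈ coneBoundary G := by
  by_cases hxC : x ∈ sufficientCone G
  · by_contra! hcon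
    obtain ⟨z, -, h1, h2⟩ := (convex_segment x y).isPreconnected _ _
      (isOpen_sufficientCone (G := G)) isClosed_closure.isOpen_compl (fun z hz => by
        by_cases hzC : z ∈ sufficientCone G
        · exact Or.inl hzC
        · exact Or.inr fun h => hcon z hz ⟨h, hzC⟩)
      ⟨x, left_mem_segment ℝ x y, hxC⟩ ⟨y, right_mem_segment ℝ x y, hy⟩
    exact h2 (subset_closure h1)
  · exact ⟨x, left_mem_segment ℝ x y, hx, hxC⟩

end Cone

end GaussianGraph

end

/-! ### Dual certificates, and a nonzero polynomial vanishing on the boundary. -/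

noncomputable section

namespace GaussianGraph

open Matrix Topology Filter

variable {V : Type*} {G : SimpleGraph V}

open scoped MatrixOrder in
theorem PosSemidef.exists_eq_mul_transpose [Fintype V] {S : Matrix V V ℝ} (h : S.PosSemidef) :
    ∃ A : Matrix V V ℝ, S = A * Aᵀ := by
  classical
  exact CStarAlgebra.nonneg_iff_eq_mul_star_self.1 h.nonneg

/-- Complementary slackness: a boundary point is the partial matrix of a positive semidefinite
`A * Aᵀ` annihilated by a normalized positive semidefinite `B * Bᵀ` supported on `G`. -/
theorem exists_certificate_of_mem_coneBoundary [Fintype V] [DecidableEq V] {T : Edge G → ℝ}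
    (hT : T ∈ coneBoundary G) :
    ∃ A B : Matrix V V ℝ, Aᵀ * B = 0 ∧ symmRestrict G (A * Aᵀ) = T ∧
      (∀ i j, ¬(s(i, j).IsDiag ∨ s(i, j) ∈ G.edgeSet) → (B * Bᵀ) i j = 0) ∧
      (B * Bᵀ).trace = 1 := by
  obtain ⟨f, hf⟩ := geometric_hahn_banach_point_open (convex_sufficientCone (G := G))
    isOpen_sufficientCone hT.2
  -- Since the cone is stable under positive scaling, a positive `f T`, or a negative value of `f`
  -- on the cone, could be rescaled to a point of the cone with value exactly `f T`, against strict
  -- separation.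
  have hfT : f T ≤ 0 := by
    by_contra! h
    have h1 := partialOne_mem (G := G)
    have h0 : 0 < f (partialOne G) := h.trans (hf _ h1)
    have h2 := hf _ (smul_mem_sufficientCone h1 (a := f T / f (partialOne G)) (by positivity))
    rw [map_smul, smul_eq_mul, div_mul_cancel₀ _ h0.ne'] at h2
    exact h2.false
  have hfC : ∀ X ∈ sufficientCone G, 0 ≤ f X := by
    intro X hX
    by_contra! h
    have hlt := hf _ hX
    have h2 := hf _ (smul_mem_sufficientCone hX (a := f T / f X)
      (div_pos_of_neg_of_neg (hlt.trans h) h))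
    rw [map_smul, smul_eq_mul, div_mul_cancel₀ _ h.ne] at h2
    exact h2.false
  have hfcl : ∀ X ∈ closure (sufficientCone G), 0 ≤ f X := fun X hX =>
    closure_minimal (t := {X | 0 ≤ f X}) hfC (isClosed_le continuous_const f.continuous) hX
  have hfT0 : f T = 0 := le_antisymm hfT (hfcl T hT.1)
  have hw : 0 < f (partialOne G) := hfT0 ▸ hf _ partialOne_mem
  set w := f (partialOne G) with hwdef
  -- The factor `w⁻¹` makes `φ 1 = 1`, so that the matrix `K` representing `φ` has trace one.
  let φ : Matrix V V ℝ →ₗ[ℝ] ℝ := w⁻¹ • (f : (Edge G → ℝ) →ₗ[ℝ] ℝ) ∘ₗ symmRestrict G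
  have hφ : ∀ S, φ S = w⁻¹ * f (symmRestrict G S) := fun S => rfl
  let K : Matrix V V ℝ := Matrix.of fun i j => φ (Matrix.single i j 1)
  have hφK : ∀ S, φ S = ∑ i, ∑ j, S i j * K i j := by
    intro S
    conv_lhs => rw [matrix_eq_sum_single S]
    simp only [map_sum]
    refine Finset.sum_congr rfl fun i _ => Finset.sum_congr rfl fun j _ => ?_
    have h1 : K i j = φ (single i j 1) := rfl
    rw [h1, ← smul_eq_mul, ← map_smul, smul_single, smul_eq_mul, mul_one]
  have hKsymm : K.IsHermitian := by
    ext i j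
    simp only [K, conjTranspose_apply, of_apply, star_trivial, hφ]
    congr 2
    ext ⟨e, he⟩
    induction e with
    | _ a b => simp only [symmRestrict_mk, single_apply, and_comm, add_comm]
  have hKpsd : K.PosSemidef := by
    refine .of_dotProduct_mulVec_nonneg hKsymm fun x => ?_
    have h1 : star x ⬝ᵥ K *ᵥ x = φ (vecMulVec x x) := by
      rw [hφK]
      simp only [dotProduct, mulVec, vecMulVec_apply, star_trivial, Finset.mul_sum]
      exact Finset.sum_congr rfl fun i _ => Finset.sum_congr rfl fun j _ => by ring
    have hpsd : (vecMulVec x x).PosSemidef := by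
      simpa using posSemidef_vecMulVec_self_star x
    have hε : ∀ ε : ℝ, 0 < ε → 0 ≤ φ (vecMulVec x x) + ε := by
      intro ε hε
      have h2 : symmRestrict G (vecMulVec x x + ε • 1) ∈ sufficientCone G :=
        mem_sufficientCone_iff.2 ⟨_, PosDef.posSemidef_add hpsd (PosDef.one.smul hε), rfl⟩
      have h3 : φ (vecMulVec x x + ε • 1) = φ (vecMulVec x x) + ε := by
        rw [map_add, map_smul, hφ 1]
        rw [symmRestrict_one, ← hwdef, inv_mul_cancel₀ hw.ne', smul_eq_mul, mul_one]
      rw [← h3, hφ]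
      exact mul_nonneg (inv_nonneg.2 hw.le) (hfC _ h2)
    rw [h1]
    exact le_of_forall_pos_le_add hε
  obtain ⟨S, hS, hST⟩ := exists_posSemidef_of_mem_closure hT.1
  obtain ⟨A, rfl⟩ := PosSemidef.exists_eq_mul_transpose hS
  obtain ⟨B, hB⟩ := PosSemidef.exists_eq_mul_transpose hKpsd
  refine ⟨A, B, ?_, hST, fun i j hij => ?_, ?_⟩
  · have h0 : φ (A * Aᵀ) = 0 := by rw [hφ, hST, hfT0, mul_zero]
    have h1 : φ (A * Aᵀ) = ((A * Aᵀ) * K).trace := by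
      rw [hφK]
      simp only [trace, diag, mul_apply (M := A * Aᵀ)]
      refine Finset.sum_congr rfl fun i _ => Finset.sum_congr rfl fun j _ => ?_
      rw [← hKsymm.apply i j, star_trivial]
    -- The vanishing pairing is the squared Frobenius norm of `Aᵀ * B`.
    have h2 : ((A * Aᵀ) * K).trace = ((Aᵀ * B) * (Aᵀ * B)ᴴ).trace := by
      rw [hB, conjTranspose_eq_transpose_of_trivial, transpose_mul, transpose_transpose,
        Matrix.mul_assoc A, trace_mul_comm A]
      simp only [Matrix.mul_assoc]
    exact trace_mul_conjTranspose_self_eq_zero_iff.1 (h2 ▸ h1 ▸ h0)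
  · rw [← hB]
    change φ (single i j 1) = 0
    have : symmRestrict G (single i j 1) = 0 := by
      ext ⟨e, he⟩
      induction e with
      | _ a b =>
        rw [symmRestrict_mk, single_apply, single_apply, if_neg, if_neg]
        · simp
        · rintro ⟨rfl, rfl⟩
          exact hij (by rwa [Sym2.eq_swap])
        · rintro ⟨rfl, rfl⟩
          exact hij he
    rw [hφ, this, map_zero, mul_zero]
  · have h1 : φ 1 = K.trace := by
      rw [hφK]
      simp [one_apply, trace]
    rw [← hB, ← h1, hφ, symmRestrict_one, ← hwdef, inv_mul_cancel₀ hw.ne']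

open Finset in
/-- The generic point of the certificate variety: the differentials of the entries of `A * Aᵀ`
satisfy the linear relation with coefficients `B * Bᵀ`. -/
theorem sum_smul_D_mul_transpose_eq_zero [Fintype V] {k F : Type*} [Field k] [Field F]
    [Algebra k F] {A B : Matrix V V F} (h : Aᵀ * B = 0) :
    ∑ p : V × V, (B * Bᵀ) p.1 p.2 • KaehlerDifferential.D k F ((A * Aᵀ) p.1 p.2) = 0 := by
  have h1 : (B * Bᵀ) * A = 0 := by
    have : Bᵀ * A = 0 := by
      rw [← transpose_inj, transpose_mul, transpose_transpose, h, transpose_zero]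
    rw [Matrix.mul_assoc, this, Matrix.mul_zero]
  have h2 : Aᵀ * (B * Bᵀ) = 0 := by rw [← Matrix.mul_assoc, h, Matrix.zero_mul]
  rw [Fintype.sum_prod_type]
  generalize B * Bᵀ = K at *
  -- By Leibniz, each differential of an entry of `A` collects an entry of `Aᵀ * K` or of `K * A` as
  -- its coefficient.
  have e : ∀ i j, K i j • KaehlerDifferential.D k F ((A * Aᵀ) i j) =
      ∑ l, (A i l * K i j) • KaehlerDifferential.D k F (A j l) +
      ∑ l, (K i j * A j l) • KaehlerDifferential.D k F (A i l) := by
    intro i j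
    simp only [mul_apply, transpose_apply, map_sum, Derivation.leibniz, smul_sum, smul_add,
      sum_add_distrib, smul_smul]
    simp only [mul_comm]
  simp only [e, sum_add_distrib]
  have hc1 : ∀ j l, ∑ i, A i l * K i j = 0 := fun j l => by
    simpa [mul_apply] using congr_fun (congr_fun h2 l) j
  have hc2 : ∀ i l, ∑ j, K i j * A j l = 0 := fun i l => by
    simpa [mul_apply] using congr_fun (congr_fun h1 i) l
  have s1 : ∑ i, ∑ j, ∑ l, (A i l * K i j) • KaehlerDifferential.D k F (A j l) = 0 := by
    rw [sum_comm]
    refine sum_eq_zero fun j _ => ?_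
    rw [sum_comm]
    refine sum_eq_zero fun l _ => ?_
    rw [← sum_smul, hc1, zero_smul]
  have s2 : ∑ i, ∑ j, ∑ l, (K i j * A j l) • KaehlerDifferential.D k F (A i l) = 0 := by
    refine sum_eq_zero fun i _ => ?_
    rw [sum_comm]
    refine sum_eq_zero fun l _ => ?_
    rw [← sum_smul, hc2, zero_smul]
  rw [s1, s2, add_zero]

-- The certificates form the real algebraic set `Z`, and the boundary lies in its image under the
-- entries of `A * Aᵀ`. The relation with coefficients `B * Bᵀ` is nontrivial at every generic point
-- thanks to the trace normalization.
open MvPolynomial in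
theorem exists_ne_zero_forall_mem_coneBoundary [Fintype V] [DecidableEq V] (G : SimpleGraph V) :
    ∃ f : MvPolynomial (Edge G) ℝ, f ≠ 0 ∧ ∀ T ∈ coneBoundary G, aeval T f = 0 := by
  classical
  let τ := V × V ⊕ V × V
  let A : Matrix V V (MvPolynomial τ ℝ) := Matrix.of fun i j => X (Sum.inl (i, j))
  let B : Matrix V V (MvPolynomial τ ℝ) := Matrix.of fun i j => X (Sum.inr (i, j))
  let Z : Set (τ → ℝ) := {z | (∀ i j, aeval z ((Aᵀ * B) i j) = 0) ∧
    (∀ i j, ¬(s(i, j).IsDiag ∨ s(i, j) ∈ G.edgeSet) → aeval z ((B * Bᵀ) i j) = 0) ∧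
    aeval z ((B * Bᵀ).trace - 1) = 0}
  have hsymm : ∀ {R : Type _} [CommRing R] (M : Matrix V V R) (i j : V),
      (M * Mᵀ) i j = (M * Mᵀ) j i := fun M i j => by simp [mul_apply, mul_comm]
  let t : Edge G → MvPolynomial τ ℝ := fun e =>
    Sym2.lift ⟨fun i j => (A * Aᵀ) i j, fun i j => hsymm A i j⟩ e.1
  -- Ordered pairs are summed, so an edge that is not a loop gets its coefficient twice and a loop
  -- once.
  let c : Edge G → MvPolynomial τ ℝ := fun e =>
    ∑ p : V × V with s(p.1, p.2) = e.1, (B * Bᵀ) p.1 p.2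
  have hZ : ∃ f : MvPolynomial (Edge G) ℝ, f ≠ 0 ∧
      ∀ z ∈ Z, aeval (fun e => aeval z (t e)) f = 0 := by
    refine exists_ne_zero_aeval_eq_zero_of_kaehlerDifferential Z t c ?_
    intro P _ F hP
    let ψ := algebraMap (MvPolynomial τ ℝ) F
    have hψ : ∀ q, (∀ z ∈ Z, aeval z q = 0) → ψ q = 0 := fun q hq => by
      have : q ∈ P := hP hq
      simp only [ψ, IsScalarTower.algebraMap_apply (MvPolynomial τ ℝ) (MvPolynomial τ ℝ ⧸ P) F]
      rw [show algebraMap (MvPolynomial τ ℝ) (MvPolynomial τ ℝ ⧸ P) q = 0 from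
        Ideal.Quotient.eq_zero_iff_mem.2 this, map_zero]
    have hmul : ∀ (M N : Matrix V V (MvPolynomial τ ℝ)) i j,
        ψ ((M * N) i j) = (M.map ψ * N.map ψ) i j := fun M N i j => by
      rw [← Matrix.map_mul, map_apply]
    have hAB : (A.map ψ)ᵀ * B.map ψ = 0 := by
      ext i j
      exact (hmul _ _ i j).symm.trans (hψ _ fun z hz => hz.1 i j)
    have hrel := sum_smul_D_mul_transpose_eq_zero (k := ℝ) hAB
    have hK : ∀ i j, ψ ((B * Bᵀ) i j) = (B.map ψ * (B.map ψ)ᵀ) i j := fun i j =>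
      hmul B Bᵀ i j
    have hS : ∀ i j, ψ ((A * Aᵀ) i j) = (A.map ψ * (A.map ψ)ᵀ) i j := fun i j =>
      hmul A Aᵀ i j
    constructor
    · rw [← hrel]
      have h1 : ∀ e : Edge G, ψ (c e) • KaehlerDifferential.D ℝ F (ψ (t e)) =
          ∑ p : V × V with s(p.1, p.2) = e.1, ψ ((B * Bᵀ) p.1 p.2) •
            KaehlerDifferential.D ℝ F (ψ ((A * Aᵀ) p.1 p.2)) := by
        intro e
        rw [map_sum, Finset.sum_smul]
        refine Finset.sum_congr rfl fun p hp => ?_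
        have : t e = (A * Aᵀ) p.1 p.2 := by
          simp only [t, ← (Finset.mem_filter.1 hp).2]
          rfl
        rw [this]
      rw [Finset.sum_congr rfl fun e _ => h1 e]
      simp only [← hK, ← hS, Finset.sum_filter]
      rw [Finset.sum_comm]
      refine Finset.sum_congr rfl fun p _ => ?_
      by_cases hp : s(p.1, p.2).IsDiag ∨ s(p.1, p.2) ∈ G.edgeSet
      · rw [Finset.sum_eq_single ⟨s(p.1, p.2), hp⟩]
        · simp
        · intro e _ he
          rw [if_neg]
          rintro h
          exact he (Subtype.ext h.symm)
        · simp
      · rw [hψ _ fun z hz => hz.2.1 _ _ hp]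
        simp
    · by_contra! hc
      have h1 : ∀ i, ψ ((B * Bᵀ) i i) = 0 := by
        intro i
        rw [← hc (loop G i)]
        congr 1
        simp only [c, loop]
        rw [Finset.sum_eq_single_of_mem (i, i) (by simp)]
        rintro ⟨a, b⟩ hp hne
        simp at hp
        exact absurd (Prod.ext hp.1 hp.2) hne
      have h2 := hψ ((B * Bᵀ).trace - 1) fun z hz => hz.2.2
      rw [map_sub, map_one, trace, map_sum, Finset.sum_congr rfl (fun _ _ => congrArg ψ (diag_apply _ _)), Finset.sum_eq_zero (fun i _ => h1 i), zero_sub,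
        neg_eq_zero] at h2
      exact one_ne_zero h2
  obtain ⟨f, hf0, hf⟩ := hZ
  refine ⟨f, hf0, fun T hT => ?_⟩
  obtain ⟨a, b, hab, haT, hbG, hbtr⟩ := exists_certificate_of_mem_coneBoundary hT
  let z : τ → ℝ := Sum.elim (fun p => a p.1 p.2) (fun p => b p.1 p.2)
  have hA : A.map (aeval z) = a := by ext i j; simp [A, z]
  have hB : B.map (aeval z) = b := by ext i j; simp [B, z]
  have hmulA : ∀ i j, aeval z ((A * Aᵀ) i j) = (a * aᵀ) i j := fun i j => by
    rw [← hA]; simp [mul_apply]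
  have hmulB : ∀ i j, aeval z ((B * Bᵀ) i j) = (b * bᵀ) i j := fun i j => by
    rw [← hB]; simp [mul_apply]
  have hz : z ∈ Z := by
    refine ⟨fun i j => ?_, fun i j hij => ?_, ?_⟩
    · have := congr_fun (congr_fun hab i) j
      rw [← hA, ← hB] at this
      simpa [mul_apply] using this
    · rw [hmulB, hbG i j hij]
    · rw [map_sub, map_one, ← hbtr, sub_eq_zero]
      simp only [trace, diag, map_sum, hmulB]
  have := hf z hz
  convert this using 2
  ext ⟨e, he⟩
  induction e with
  | _ i j =>
    have h1 : (a * aᵀ).IsHermitian := by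
      simpa using isHermitian_mul_conjTranspose_self a
    rw [aeval_X, aeval_X, ← haT, ← extends_symmRestrict (G := G) h1 i j he]
    exact (hmulA i j).symm

end GaussianGraph

end

/-! ### Elimination along lines, and principality of the vanishing ideal. -/

noncomputable section

section Elimination

open Polynomial

attribute [local instance] Polynomial.algebra

/-- If no polynomial of positive degree divides all members of an ideal of `R[X]`, then the ideal
contains a nonzero constant. -/
theorem Polynomial.exists_C_mem_of_forall_dvd {R : Type*} [CommRing R] [IsDomain R]
    [UniqueFactorizationMonoid R] (I : Ideal R[X])
    (hI : ∀ p : R[X], (∀ f ∈ I, p ∣ f) → p.natDegree = 0) : ∃ r : R, r ≠ 0 ∧ C r ∈ I := by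
  let K := FractionRing R
  let : NormalizedGCDMonoid R := Nonempty.some inferInstance
  have hloc := Polynomial.isLocalization (nonZeroDivisors R) K
  by_cases htop : I.map (algebraMap R[X] K[X]) = ⊤
  · have h1 : (1 : K[X]) ∈ I.map (algebraMap R[X] K[X]) := htop ▸ Submodule.mem_top
    rw [IsLocalization.mem_map_algebraMap_iff ((nonZeroDivisors R).map (C : R →+* R[X]))] at h1
    obtain ⟨⟨⟨i, hi⟩, ⟨_, r, hr, rfl⟩⟩, h⟩ := h1
    rw [one_mul] at h
    have : C r = i := Polynomial.map_injective _ (IsFractionRing.injective R K) h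
    exact ⟨r, nonZeroDivisors.ne_zero hr, this ▸ hi⟩
  exfalso
  -- Over the fraction field the ideal has a single generator `d`. After clearing denominators, its
  -- primitive part divides every member of `I` over `R` by Gauss's lemma; so `d` has degree zero
  -- and is a unit.
  obtain ⟨d, hd⟩ := (IsPrincipalIdealRing.principal (I.map (algebraMap R[X] K[X]))).principal
  have hdvd : ∀ f ∈ I, d ∣ f.map (algebraMap R K) := by
    intro f hf
    rw [← Ideal.mem_span_singleton]
    have : algebraMap R[X] K[X] f ∈ I.map (algebraMap R[X] K[X]) := Ideal.mem_map_of_mem _ hf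
    rw [hd] at this
    exact this
  have hd0 : d ≠ 0 := by
    rintro rfl
    have := hI X fun f hf => by
      have := zero_dvd_iff.1 (hdvd f hf)
      rw [Polynomial.map_eq_zero_iff (IsFractionRing.injective R K)] at this
      rw [this]
      exact dvd_zero _
    simp at this
  have hdu : ¬IsUnit d := fun h => htop (hd.trans (Ideal.span_singleton_eq_top.2 h))
  obtain ⟨b, hb, hbd⟩ := IsLocalization.integerNormalization_spec (nonZeroDivisors R) d
  set q := IsLocalization.integerNormalization (nonZeroDivisors R) d
  have hb0 : algebraMap R K b ≠ 0 := by
    simpa using nonZeroDivisors.ne_zero hb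
  have hbd' : q.map (algebraMap R K) = C (algebraMap R K b) * d := by
    rw [hbd, ← smul_eq_C_mul, algebraMap_smul]
  have hq0 : q ≠ 0 := by
    intro h
    rw [h, Polynomial.map_zero] at hbd'
    exact mul_ne_zero (C_ne_zero.2 hb0) hd0 hbd'.symm
  have hdeg : q.primPart.natDegree = d.natDegree := by
    rw [natDegree_primPart, ← natDegree_map_eq_of_injective (IsFractionRing.injective R K), hbd',
      natDegree_C_mul hb0]
  have hprim : q.primPart.map (algebraMap R K) ∣ d := by
    have h1 : q.primPart.map (algebraMap R K) ∣ q.map (algebraMap R K) :=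
      Polynomial.map_dvd _ q.primPart_dvd
    rw [hbd'] at h1
    exact ((isUnit_C.2 hb0.isUnit).dvd_mul_left).1 h1
  have h0 := hI q.primPart fun f hf =>
    q.isPrimitive_primPart.dvd_of_fraction_map_dvd_fraction_map (hprim.trans (hdvd f hf))
  rw [hdeg] at h0
  refine hdu ?_
  rw [eq_C_of_natDegree_eq_zero h0] at hd0 ⊢
  exact isUnit_C.2 (C_ne_zero.1 hd0).isUnit

variable {σ k : Type*} [Field k]

/-- The substitution `x ↦ x + Y w` of the points on the line through the generic point in
direction `w`. -/
def lineSubst (w : σ → k) : MvPolynomial σ k →ₐ[k] (MvPolynomial σ k)[X] :=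
  MvPolynomial.aeval fun i => C (MvPolynomial.X i) + C (MvPolynomial.C (w i)) * X

@[simp]
theorem lineSubst_C (w : σ → k) (a : k) : lineSubst w (MvPolynomial.C a) = C (MvPolynomial.C a) :=
  (lineSubst w).commutes a

theorem lineSubst_X (w : σ → k) (i : σ) :
    lineSubst w (MvPolynomial.X i) = C (MvPolynomial.X i) + C (MvPolynomial.C (w i)) * X :=
  MvPolynomial.aeval_X _ i

theorem eval₂_lineSubst (w y : σ → k) (s : k) (f : MvPolynomial σ k) :
    (lineSubst w f).eval₂ (MvPolynomial.eval y) s = MvPolynomial.eval (y + s • w) f := by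
  induction f using MvPolynomial.induction_on with
  | C a => simp
  | add p q hp hq => simp [Polynomial.eval₂_add, hp, hq]
  | mul_X p i hp =>
    rw [map_mul, Polynomial.eval₂_mul, hp, lineSubst_X]
    simp [mul_comm s]

/-- Translations by `Y w` and `-Y w` with `Y` fixed cancel: `x ↦ x + Y w` extends to an automorphism
of `k[x][Y]`. -/
theorem eval₂_neg_lineSubst (w : σ → k) (f : MvPolynomial σ k) :
    (lineSubst w f).eval₂ (lineSubst (-w) : MvPolynomial σ k →+* (MvPolynomial σ k)[X]) X = C f := by
  induction f using MvPolynomial.induction_on with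
  | C a => simp
  | add p q hp hq => rw [map_add, Polynomial.eval₂_add, hp, hq, map_add]
  | mul_X p i hp =>
    rw [map_mul, Polynomial.eval₂_mul, hp, map_mul, lineSubst_X]
    congr 1
    simp [lineSubst_X]
    ring

theorem eval₂_eval₂_neg_lineSubst (w : σ → k) (f : (MvPolynomial σ k)[X]) :
    (f.eval₂ (lineSubst (-w) : MvPolynomial σ k →+* (MvPolynomial σ k)[X]) X).eval₂
      (lineSubst w : MvPolynomial σ k →+* (MvPolynomial σ k)[X]) X = f := by
  induction f using Polynomial.induction_on' with
  | add p q hp hq => rw [eval₂_add, eval₂_add, hp, hq]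
  | monomial n a =>
    have := eval₂_neg_lineSubst (-w) a
    rw [neg_neg] at this
    rw [eval₂_monomial, eval₂_mul, eval₂_X_pow, RingHom.coe_coe, this, C_mul_X_pow_eq_monomial]

/-- If the members of `J` have no common factor, then the parameter of a line in any direction
can be eliminated from them. -/
theorem exists_C_mem_map_lineSubst (w : σ → k)
    (J : Ideal (MvPolynomial σ k)) (hJ : ∀ d, (∀ f ∈ J, d ∣ f) → IsUnit d) :
    ∃ r : MvPolynomial σ k, r ≠ 0 ∧ C r ∈ J.map (lineSubst w) := by
  refine Polynomial.exists_C_mem_of_forall_dvd _ fun p hp => ?_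
  -- The inverse translation carries `J.map (lineSubst w)` back to the extension of `J`. A common
  -- divisor then divides polynomials free of the line parameter, hence is free of it too, and is a
  -- common divisor of `J`.
  let Ψ : (MvPolynomial σ k)[X] →+* (MvPolynomial σ k)[X] :=
    eval₂RingHom (lineSubst (-w) : MvPolynomial σ k →+* (MvPolynomial σ k)[X]) X
  have h1 : ∀ f ∈ J, Ψ p ∣ C f := fun f hf => by
    rw [← eval₂_neg_lineSubst w f]
    exact map_dvd Ψ (hp _ (Ideal.mem_map_of_mem _ hf))
  obtain ⟨f₀, hf₀J, hf₀⟩ : ∃ f ∈ J, f ≠ 0 := by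
    by_contra! h
    exact not_isUnit_zero (hJ 0 fun f hf => by rw [h f hf])
  have h2 : (Ψ p).natDegree = 0 := by
    have := natDegree_le_of_dvd (h1 f₀ hf₀J) (C_ne_zero.2 hf₀)
    rwa [natDegree_C, Nat.le_zero] at this
  rw [eq_C_of_natDegree_eq_zero h2] at h1
  have h3 : IsUnit (Ψ p) := by
    rw [eq_C_of_natDegree_eq_zero h2]
    exact isUnit_C.2 (hJ _ fun f hf => Polynomial.C_dvd_iff_dvd_coeff _ _ |>.1 (h1 f hf) 0 |>.trans (by rw [coeff_C_zero]))
  have h4 : IsUnit p := by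
    rw [← eval₂_eval₂_neg_lineSubst w p]
    exact h3.map (eval₂RingHom (lineSubst w : MvPolynomial σ k →+* (MvPolynomial σ k)[X]) X)
  exact natDegree_eq_zero_of_isUnit h4

end Elimination

section Hypersurface

open MvPolynomial Topology

/-- The complexification, respectively the identity, on real points. -/
abbrev castPoint (𝕜 : Type*) [RCLike 𝕜] {σ : Type*} (T : σ → ℝ) : σ → 𝕜 := fun e => (T e : 𝕜)

theorem MvPolynomial.eq_zero_of_eventually_aeval_castPoint {𝕜 σ : Type*} [RCLike 𝕜] [Finite σ]
    {x : σ → ℝ} {r : MvPolynomial σ 𝕜} (h : ∀ᶠ y in 𝓝 x, aeval (castPoint 𝕜 y) r = 0) : r = 0 := by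
  have := Fintype.ofFinite σ
  obtain ⟨ε, hε, hball⟩ := Metric.eventually_nhds_iff_ball.1 h
  refine funext_set (fun i => (fun a : ℝ => (a : 𝕜)) '' Metric.ball (x i) ε) (fun i => ?_) ?_
  · refine Set.Infinite.image RCLike.ofReal_injective.injOn ?_
    rw [Real.ball_eq_Ioo]
    exact Set.Ioo_infinite (by linarith)
  · intro z hz
    choose y hy hyz using fun i => hz i (Set.mem_univ i)
    obtain rfl : castPoint 𝕜 y = z := _root_.funext hyz
    rw [map_zero, ← aeval_eq_eval]
    exact hball y (by rw [ball_pi _ hε]; exact fun i _ => hy i)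

theorem MvPolynomial.continuous_aeval_castPoint {𝕜 σ : Type*} [RCLike 𝕜] (g : MvPolynomial σ 𝕜) :
    Continuous fun y : σ → ℝ => aeval (castPoint 𝕜 y) g := by
  simp only [aeval_eq_eval]
  exact (continuous_eval g).comp (by fun_prop)

/-- Take a common divisor of largest total degree: a nonconstant common factor of the cofactors
would enlarge it. -/
theorem MvPolynomial.exists_maximal_commonDvd {σ k : Type*} [Field k]
    (I : Ideal (MvPolynomial σ k)) (hI : ∃ f ∈ I, f ≠ 0) :
    ∃ g, (∀ f ∈ I, g ∣ f) ∧ ∀ d, (∀ f, g * f ∈ I → d ∣ f) → IsUnit d := by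
  obtain ⟨f₀, hf₀, hne⟩ := hI
  let N : Set ℕ := {n | ∃ g : MvPolynomial σ k, (∀ f ∈ I, g ∣ f) ∧ g.totalDegree = n}
  have hN : N.Nonempty := ⟨_, 1, fun f _ => one_dvd f, rfl⟩
  have hbdd : BddAbove N := ⟨f₀.totalDegree, by
    rintro _ ⟨g, hg, rfl⟩
    exact totalDegree_le_of_dvd_of_isDomain (hg f₀ hf₀) hne⟩
  obtain ⟨g, hg, hgN⟩ := Nat.sSup_mem hN hbdd
  refine ⟨g, hg, fun d hd => ?_⟩
  have h1 : ∀ f ∈ I, g * d ∣ f := by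
    intro f hf
    obtain ⟨h, rfl⟩ := hg f hf
    exact mul_dvd_mul_left g (hd h hf)
  have hgd : g * d ≠ 0 := fun h => hne (zero_dvd_iff.1 (h ▸ h1 f₀ hf₀))
  have h2 := le_csSup hbdd ⟨g * d, h1, rfl⟩
  rw [← hgN, totalDegree_mul_of_isDomain (left_ne_zero_of_mul hgd) (right_ne_zero_of_mul hgd)] at h2
  have h3 : d.totalDegree = 0 := by omega
  have hd0 := right_ne_zero_of_mul hgd
  rw [totalDegree_eq_zero_iff_eq_C.1 h3] at hd0 ⊢
  exact (IsUnit.mk0 _ (fun h => hd0 (by rw [h, C_0]))).map C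

/-- If a set of real points is locally hit by all lines in a fixed direction and is not Zariski
dense, then its Zariski closure is a hypersurface. -/
theorem exists_vanishingIdeal_eq_span_singleton {𝕜 σ : Type*} [RCLike 𝕜] [Finite σ]
    (S : Set (σ → ℝ)) (w : σ → ℝ)
    (hS : ∀ x ∈ S, ∀ ε > 0, ∀ᶠ y in 𝓝 x, ∃ s : ℝ, |s| ≤ ε ∧ y + s • w ∈ S)
    (hI : ∃ f ∈ vanishingIdeal 𝕜 (castPoint 𝕜 '' S), f ≠ 0) :
    ∃ H ≠ 0, vanishingIdeal 𝕜 (castPoint 𝕜 '' S) = Ideal.span {H} := by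
  set I := vanishingIdeal 𝕜 (castPoint 𝕜 '' S)
  obtain ⟨g, hg, hmax⟩ := MvPolynomial.exists_maximal_commonDvd I hI
  obtain ⟨f₀, hf₀, hne⟩ := hI
  refine ⟨g, fun h => hne (zero_dvd_iff.1 (h ▸ hg f₀ hf₀)), le_antisymm (fun f hf =>
    Ideal.mem_span_singleton.2 (hg f hf)) ((Ideal.span_singleton_le_iff_mem _).2 ?_)⟩
  -- The members of the colon ideal `(I : g)` have no common factor, so `r ≠ 0` arises by
  -- eliminating the line parameter. If `g` did not vanish at `x`, then for every `y` near `x` all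
  -- of `J` would vanish at some `y + s • w`, forcing `r` to vanish at `y`.
  let J : Ideal (MvPolynomial σ 𝕜) := Submodule.comap (LinearMap.mulLeft (MvPolynomial σ 𝕜) g) I
  obtain ⟨r, hr0, hr⟩ := exists_C_mem_map_lineSubst (castPoint 𝕜 w) J hmax
  rintro _ ⟨x, hx, rfl⟩
  by_contra hgx
  refine hr0 (MvPolynomial.eq_zero_of_eventually_aeval_castPoint (x := x) ?_)
  have hcont : Continuous fun p : ℝ × (σ → ℝ) => aeval (castPoint 𝕜 (p.2 + p.1 • w)) g :=
    (MvPolynomial.continuous_aeval_castPoint g).comp (by fun_prop)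
  have hev : ∀ᶠ p : ℝ × (σ → ℝ) in 𝓝 (0, x), aeval (castPoint 𝕜 (p.2 + p.1 • w)) g ≠ 0 :=
    hcont.continuousAt.eventually_ne (by simpa using hgx)
  rw [nhds_prod_eq] at hev
  obtain ⟨p, hp, q, hq, hpq⟩ := Filter.eventually_prod_iff.1 hev
  obtain ⟨ε, hε, hball⟩ := Metric.eventually_nhds_iff_ball.1 hp
  filter_upwards [hq, hS x hx (ε / 2) (half_pos hε)] with y hy hyS
  obtain ⟨s, hs, hsS⟩ := hyS
  have hne : aeval (castPoint 𝕜 (y + s • w)) g ≠ 0 :=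
    hpq (hball s (by rw [Metric.mem_ball, dist_zero_right, Real.norm_eq_abs]; linarith)) hy
  let ev := Polynomial.eval₂RingHom (MvPolynomial.eval (castPoint 𝕜 y)) (s : 𝕜)
  have hker : J.map (lineSubst (castPoint 𝕜 w)) ≤ RingHom.ker ev := by
    rw [Ideal.map_le_iff_le_comap]
    intro f hf
    have h1 : aeval (castPoint 𝕜 (y + s • w)) (g * f) = 0 := hf _ ⟨_, hsS, rfl⟩
    rw [map_mul, mul_eq_zero, or_iff_right hne] at h1
    rw [Ideal.mem_comap, RingHom.mem_ker]
    change Polynomial.eval₂ _ _ _ = 0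
    rw [eval₂_lineSubst, ← h1, aeval_eq_eval]
    congr 2
    ext i
    simp [castPoint]
  have := hker hr
  rw [RingHom.mem_ker] at this
  simpa [ev, aeval_eq_eval] using this

end Hypersurface

namespace GaussianGraph

open Topology MvPolynomial

variable {V : Type*} {G : SimpleGraph V}

/-- Adding `ε` times the identity moves `x` into the open cone; subtracting it leaves the closure,
since otherwise `x` would lie in the cone. Both persist near `x`, and the segment between must cross
the boundary. -/
theorem eventually_exists_mem_coneBoundary [Fintype V] {x : Edge G → ℝ} (hx : x ∈ coneBoundary G)
    {ε : ℝ} (hε : 0 < ε) :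
    ∀ᶠ y in 𝓝 x, ∃ s : ℝ, |s| ≤ ε ∧ y + s • partialOne G ∈ coneBoundary G := by
  have h1 : ∀ᶠ y in 𝓝 x, y + ε • partialOne G ∈ sufficientCone G :=
    (Continuous.tendsto (f := fun y => y + ε • partialOne G) (by fun_prop) x).eventually
      (isOpen_sufficientCone.mem_nhds (add_smul_partialOne_mem hx.1 hε))
  have h2 : ∀ᶠ y in 𝓝 x, y - ε • partialOne G ∈ (closure (sufficientCone G))ᶜ := by
    refine (Continuous.tendsto (f := fun y => y - ε • partialOne G) (by fun_prop) x).eventually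
      (isClosed_closure.isOpen_compl.mem_nhds fun h => hx.2 ?_)
    simpa using add_smul_partialOne_mem h hε
  filter_upwards [h1, h2] with y hy1 hy2
  obtain ⟨z, ⟨a, b, ha, hb, hab, rfl⟩, hz⟩ := exists_mem_coneBoundary (subset_closure hy1) hy2
  refine ⟨(a - b) * ε, ?_, ?_⟩
  · rw [abs_mul, abs_of_pos hε]
    exact mul_le_of_le_one_left hε.le (abs_le.2 ⟨by linarith, by linarith⟩)
  · convert hz using 1
    obtain rfl : a = 1 - b := by linarith
    module

theorem exists_isDefiningPolynomial (𝕜 : Type*) [RCLike 𝕜] [Finite V] (G : SimpleGraph V) :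
    ∃ H, IsDefiningPolynomial 𝕜 G H := by
  classical
  have := Fintype.ofFinite V
  obtain ⟨f, hf0, hf⟩ := exists_ne_zero_forall_mem_coneBoundary G
  refine exists_vanishingIdeal_eq_span_singleton (coneBoundary G) (partialOne G)
    (fun x hx ε hε => eventually_exists_mem_coneBoundary hx hε)
    ⟨map (algebraMap ℝ 𝕜) f, ?_, ?_⟩
  · rintro _ ⟨T, hT, rfl⟩
    rw [aeval_map_algebraMap]
    have := aeval_algebraMap_apply 𝕜 T f
    rw [hf T hT, map_zero] at this
    exact this
  · rwa [Ne, map_eq_zero_iff _ (map_injective _ (algebraMap ℝ 𝕜).injective)]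

end GaussianGraph

end

/-! ### Schur complements and the boundary for the suspension graph. -/

noncomputable section

namespace GaussianGraph

variable {V : Type*} {G : SimpleGraph V}

section Positions

/-- The positions `(0, o)` of the suspension graph. -/
def apex (G : SimpleGraph V) : Option V → Edge (suspension G)
  | none => apexLoop G
  | some i => apexEdge G i

/-- The positions of the suspension graph: those of the apex, and those of the base. -/
def positionEquiv (G : SimpleGraph V) : Option V ⊕ Edge G ≃ Edge (suspension G) :=
  Equiv.ofBijective (Sum.elim (apex G) (baseEdge G)) <| by
    have hval : ∀ o, (apex G o).1 = s(none, o) := by rintro (_ | i) <;> rfl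
    have hne : ∀ o (e : Edge G), apex G o ≠ baseEdge G e := by
      intro o e h
      have h1 : none ∈ (baseEdge G e).1 := by
        rw [← h, hval]
        exact Sym2.mem_mk_left _ _
      obtain ⟨x, -, hx⟩ := Sym2.mem_map.1 h1
      cases hx
    constructor
    · rintro (o | e) (o' | e') h
      · have h1 := congrArg Subtype.val (show apex G o = apex G o' from h)
        rw [hval, hval] at h1
        rcases Sym2.eq_iff.1 h1 with ⟨-, rfl⟩ | ⟨rfl, rfl⟩ <;> rfl
      · exact absurd h (hne o e')
      · exact absurd h.symm (hne o' e)
      · have h1 := congrArg Subtype.val (show baseEdge G e = baseEdge G e' from h)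
        exact congrArg Sum.inr
          (Subtype.ext (Sym2.map.injective (Option.some_injective V) h1))
    · rintro ⟨z, hz⟩
      induction z with
      | _ a b =>
        rcases a with _ | i
        · exact ⟨Sum.inl b, Subtype.ext (hval b)⟩
        rcases b with _ | j
        · exact ⟨Sum.inl (some i), Subtype.ext ((hval (some i)).trans Sym2.eq_swap)⟩
        · refine ⟨Sum.inr ⟨s(i, j), hz.imp (fun h => ?_) id⟩, rfl⟩
          exact Option.some_injective V h

@[simp]
theorem positionEquiv_symm_apex (o : Option V) :
    (positionEquiv G).symm (apex G o) = Sum.inl o :=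
  (positionEquiv G).symm_apply_apply (Sum.inl o)

@[simp]
theorem positionEquiv_symm_baseEdge (e : Edge G) :
    (positionEquiv G).symm (baseEdge G e) = Sum.inr e :=
  (positionEquiv G).symm_apply_apply (Sum.inr e)

theorem position_cases {motive : Edge (suspension G) → Prop} (apex : ∀ o, motive (apex G o))
    (base : ∀ e, motive (baseEdge G e)) (e : Edge (suspension G)) : motive e := by
  obtain ⟨o | e, rfl⟩ := (positionEquiv G).surjective e
  · exact apex o
  · exact base e

/-- The partial matrix on the suspension graph with given apex row and base part. -/
def join {K : Type*} (x : Option V → K) (T : Edge G → K) : Edge (suspension G) → K :=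
  Sum.elim x T ∘ (positionEquiv G).symm

@[simp]
theorem join_apex {K : Type*} (x : Option V → K) (T : Edge G → K) (o : Option V) :
    join x T (apex G o) = x o := by simp [join]

@[simp]
theorem join_apexLoop {K : Type*} (x : Option V → K) (T : Edge G → K) :
    join x T (apexLoop G) = x none := join_apex x T none

@[simp]
theorem join_apexEdge {K : Type*} (x : Option V → K) (T : Edge G → K) (i : V) :
    join x T (apexEdge G i) = x (some i) := join_apex x T (some i)

@[simp]
theorem join_baseEdge {K : Type*} (x : Option V → K) (T : Edge G → K) (e : Edge G) :
    join x T (baseEdge G e) = T e := by simp [join]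

theorem join_self {K : Type*} (u : Edge (suspension G) → K) :
    join (u ∘ apex G) (u ∘ baseEdge G) = u := by
  ext e
  induction e using position_cases <;> simp

variable {K : Type*} [CommRing K]

/-- The transvection `u_ij ↦ u_ij + a u_0i u_0j` of the base coordinates. -/
def shear (a : K) (u : Edge (suspension G) → K) : Edge (suspension G) → K :=
  join (u ∘ apex G) fun e => u (baseEdge G e) + a * (e.1.map fun i => u (apexEdge G i)).mul

@[simp]
theorem shear_apex (a : K) (u : Edge (suspension G) → K) (o : Option V) :
    shear a u (apex G o) = u (apex G o) := by simp [shear]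

@[simp]
theorem shear_apexLoop (a : K) (u : Edge (suspension G) → K) :
    shear a u (apexLoop G) = u (apexLoop G) := shear_apex a u none

@[simp]
theorem shear_apexEdge (a : K) (u : Edge (suspension G) → K) (i : V) :
    shear a u (apexEdge G i) = u (apexEdge G i) := shear_apex a u (some i)

theorem shear_baseEdge (a : K) (u : Edge (suspension G) → K) (e : Edge G) :
    shear a u (baseEdge G e) =
      u (baseEdge G e) + a * (e.1.map fun i => u (apexEdge G i)).mul := by simp [shear]

/-- The apex row is fixed, so the shears form an additive one-parameter group; this is why Schur
complementation can be undone. -/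
theorem shear_shear (a b : K) (u : Edge (suspension G) → K) :
    shear a (shear b u) = shear (a + b) u := by
  ext e
  induction e using position_cases with
  | apex o => simp
  | base e =>
    simp only [shear_baseEdge, shear_apexEdge]
    ring

@[simp]
theorem shear_zero (u : Edge (suspension G) → K) : shear 0 u = u := by
  ext e
  induction e using position_cases with
  | apex o => simp
  | base e => simp [shear_baseEdge]

theorem map_sym2_mul {M N F ι : Type*} [CommMonoid M] [CommMonoid N] [FunLike F M N]
    [MonoidHomClass F M N] (f : F) (g : ι → M) (z : Sym2 ι) :
    f (z.map g).mul = (z.map fun i => f (g i)).mul := by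
  induction z with
  | _ i j => simp

theorem map_shear {L F : Type*} [CommRing L] [FunLike F K L] [RingHomClass F K L] (f : F) (a : K)
    (u : Edge (suspension G) → K) (e : Edge (suspension G)) :
    f (shear a u e) = shear (f a) (fun e => f (u e)) e := by
  induction e using position_cases with
  | apex o => simp
  | base e => simp only [shear_baseEdge, map_add, map_mul, map_sym2_mul]

/-- The Schur complement of the apex entry in a partial matrix on the suspension graph. -/
def schurComplement {K : Type*} [Field K] (u : Edge (suspension G) → K) : Edge G → K :=
  fun e => shear (-(u (apexLoop G))⁻¹) u (baseEdge G e)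

end Positions

section Cone

open Matrix Topology Filter

/-- Completion of the square in the apex variable. -/
theorem quadratic_option [Fintype V] (S : Matrix (Option V) (Option V) ℝ) (hS : S.IsHermitian)
    (h0 : S none none ≠ 0) (y : Option V → ℝ) :
    y ⬝ᵥ S *ᵥ y = S none none * (y none + (∑ i, S none (some i) * y (some i)) / S none none) ^ 2 +
      (y ∘ some) ⬝ᵥ (Matrix.of fun i j => S (some i) (some j) -
        S none (some i) * S none (some j) / S none none) *ᵥ (y ∘ some) := by
  have hsymm : ∀ i, S (some i) none = S none (some i) := fun i => by
    simpa using hS.apply none (some i)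
  set b : V → ℝ := fun i => S none (some i)
  have h1 : (y ∘ some) ⬝ᵥ (Matrix.of fun i j => S (some i) (some j) -
        b i * b j / S none none) *ᵥ (y ∘ some) =
      ∑ i, y (some i) * ∑ j, S (some i) (some j) * y (some j) -
        (∑ i, b i * y (some i)) ^ 2 / S none none := by
    rw [sq, Finset.sum_mul_sum, Finset.sum_div, ← Finset.sum_sub_distrib]
    simp only [dotProduct, mulVec, of_apply, Function.comp_apply, Finset.mul_sum, Finset.sum_div,
      ← Finset.sum_sub_distrib]
    refine Finset.sum_congr rfl fun i _ => Finset.sum_congr rfl fun j _ => by ring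
  have h2 : y ⬝ᵥ S *ᵥ y = S none none * y none ^ 2 + 2 * y none * (∑ i, b i * y (some i)) +
      ∑ i, y (some i) * ∑ j, S (some i) (some j) * y (some j) := by
    simp only [dotProduct, mulVec, Fintype.sum_option, hsymm, mul_add, Finset.sum_add_distrib]
    have : ∑ i, y (some i) * (S none (some i) * y none) = y none * ∑ i, b i * y (some i) := by
      rw [Finset.mul_sum]
      exact Finset.sum_congr rfl fun i _ => by ring
    rw [this]
    ring
  rw [h1, h2]
  field_simp
  ring

variable {u : Edge (suspension G) → ℝ}

theorem schurComplement_mk (i j : V) (h) :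
    schurComplement u ⟨s(i, j), h⟩ = u (baseEdge G ⟨s(i, j), h⟩) -
      u (apexEdge G i) * u (apexEdge G j) / u (apexLoop G) := by
  rw [schurComplement, shear_baseEdge]
  simp only [Sym2.map_mk, Sym2.mul_mk]
  ring

theorem pos_of_mem_sufficientCone_suspension (hu : u ∈ sufficientCone (suspension G)) :
    0 < u (apexLoop G) := by
  obtain ⟨S, hS, h⟩ := hu
  exact (h none none (Or.inl rfl)) ▸ hS.diag_pos

theorem comp_baseEdge_mem_sufficientCone (hu : u ∈ sufficientCone (suspension G)) :
    u ∘ baseEdge G ∈ sufficientCone G := by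
  obtain ⟨S, hS, h⟩ := hu
  exact ⟨S.submatrix some some, hS.submatrix (Option.some_injective V), fun i j hij =>
    h (some i) (some j) (baseEdge G ⟨s(i, j), hij⟩).2⟩

theorem mem_sufficientCone_suspension_iff [Fintype V] (h0 : 0 < u (apexLoop G)) :
    u ∈ sufficientCone (suspension G) ↔ schurComplement u ∈ sufficientCone G := by
  constructor
  · rintro ⟨S, hS, h⟩
    have h00 : S none none = u (apexLoop G) := h none none (Or.inl rfl)
    have h0i : ∀ i, S none (some i) = u (apexEdge G i) := fun i =>
      h none (some i) (Or.inr trivial)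
    refine ⟨Matrix.of fun i j => S (some i) (some j) -
        S none (some i) * S none (some j) / S none none, ?_, fun i j hij => ?_⟩
    · refine .of_dotProduct_mulVec_pos ?_ fun x hx => ?_
      · ext i j
        have := hS.1.apply (some i) (some j)
        simp only [star_trivial] at this
        simp only [conjTranspose_apply, of_apply, star_trivial, this]
        ring
      -- The apex coordinate is chosen to annihilate the completed square.
      · let y : Option V → ℝ := fun o =>
          o.elim (-(∑ i, S none (some i) * x i) / S none none) x
        have hy : y ≠ 0 := fun h => hx (funext fun i => congr_fun h (some i))
        have h1 := hS.dotProduct_mulVec_pos hy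
        rw [star_trivial, quadratic_option S hS.1 (h00 ▸ h0.ne')] at h1
        have h2 : y none + (∑ i, S none (some i) * y (some i)) / S none none = 0 := by
          simp only [y, Option.elim]
          ring
        rw [h2, zero_pow two_ne_zero, mul_zero, zero_add] at h1
        exact h1
    · rw [schurComplement_mk, of_apply, h00, h0i, h0i]
      congr 1
      exact h (some i) (some j) (baseEdge G ⟨s(i, j), hij⟩).2
  · rintro ⟨S, hS, h⟩
    have hsymm : ∀ i j, S j i = S i j := fun i j => by simpa using hS.1.apply i j
    -- Every `(0, i)` is a position, so `u` prescribes the whole apex row, and `S'` is the matrix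
    -- with this row and Schur complement `S`.
    let S' : Matrix (Option V) (Option V) ℝ := Matrix.of fun
      | none, o => u (apex G o)
      | some i, none => u (apexEdge G i)
      | some i, some j => S i j + u (apexEdge G i) * u (apexEdge G j) / u (apexLoop G)
    have hS' : S'.IsHermitian := by
      ext o o'
      rcases o with _ | i <;> rcases o' with _ | j <;>
        simp [S', apex, conjTranspose_apply, hsymm, mul_comm]
    have hschur : (Matrix.of fun i j => S' (some i) (some j) -
        S' none (some i) * S' none (some j) / S' none none) = S := by
      ext i j
      simp [S', apex]
    refine ⟨S', .of_dotProduct_mulVec_pos hS' fun y hy => ?_, ?_⟩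
    · have h00 : 0 < S' none none := h0
      rw [star_trivial, quadratic_option S' hS' h00.ne', hschur]
      by_cases hy' : y ∘ some = 0
      · have h1 : ∀ i, y (some i) = 0 := fun i => congr_fun hy' i
        have h2 : y none ≠ 0 := by
          intro h2
          exact hy (funext fun o => by rcases o with _ | i; exacts [h2, h1 i])
        simp only [h1, hy', mul_zero, Finset.sum_const_zero, zero_div, add_zero, zero_dotProduct]
        positivity
      · have := hS.dotProduct_mulVec_pos hy'
        rw [star_trivial] at this
        positivity
    · rintro (_ | i) (_ | j) hij
      · rfl
      · rfl
      · exact congrArg u (Subtype.ext Sym2.eq_swap)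
      · have h1 := h i j (hij.imp (fun h => Option.some_injective V h) id)
        rw [schurComplement_mk] at h1
        change S i j + _ = _
        rw [h1, sub_add_cancel]
        rfl

theorem shear_join_schurComplement {K : Type*} [Field K] (u : Edge (suspension G) → K) :
    shear (u (apexLoop G))⁻¹ (join (u ∘ apex G) (schurComplement u)) = u := by
  have : join (u ∘ apex G) (schurComplement u) = shear (-(u (apexLoop G))⁻¹) u := by
    rw [← join_self (shear _ u)]
    congr 1
    ext o
    simp
  rw [this, shear_shear, add_neg_cancel, shear_zero]

theorem schurComplement_shear_join {K : Type*} [Field K] (x : Option V → K) (T : Edge G → K) :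
    schurComplement (shear (x none)⁻¹ (join x T)) = T := by
  ext e
  rw [schurComplement, shear_shear, shear_apexLoop, join_apexLoop, neg_add_cancel, shear_zero,
    join_baseEdge]

/-- Closures correspond because the Schur complement is continuous where `u_00 ≠ 0`, as is its
inverse for a fixed apex row. -/
theorem mem_coneBoundary_suspension_iff [Fintype V] (h0 : 0 < u (apexLoop G)) :
    u ∈ coneBoundary (suspension G) ↔ schurComplement u ∈ coneBoundary G := by
  rw [coneBoundary, coneBoundary, Set.mem_sdiff, Set.mem_sdiff, mem_sufficientCone_suspension_iff h0]
  refine and_congr_left fun _ => ⟨fun h => ?_, fun h => ?_⟩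
  · refine ContinuousWithinAt.mem_closure (f := schurComplement)
      (ContinuousAt.continuousWithinAt ?_) h fun v hv =>
        (mem_sufficientCone_suspension_iff (pos_of_mem_sufficientCone_suspension hv)).1 hv
    refine continuousAt_pi.2 ?_
    rintro ⟨e, he⟩
    induction e with
    | _ i j =>
      simp only [schurComplement_mk]
      have hc : ∀ e, ContinuousAt (fun v : Edge (suspension G) → ℝ => v e) u :=
        fun e => continuousAt_apply e u
      exact (hc _).sub (((hc _).mul (hc _)).div (hc _) h0.ne')
  · rw [← shear_join_schurComplement u]
    refine map_mem_closure (f := fun T => shear (u (apexLoop G))⁻¹ (join (u ∘ apex G) T))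
      (continuous_pi fun e => ?_) h fun T hT => ?_
    · induction e using position_cases with
      | apex o => simpa using continuous_const
      | base e =>
        simp only [shear_baseEdge, join_baseEdge, join_apexEdge]
        fun_prop
    · rw [mem_sufficientCone_suspension_iff]
      · exact (schurComplement_shear_join (u ∘ apex G) T).symm ▸ hT
      · change 0 < shear (u (apexLoop G))⁻¹ (join (u ∘ apex G) T) (apexLoop G)
        rw [shear_apexLoop, join_apexLoop]
        exact h0

theorem PosSemidef.eq_zero_of_diag_eq_zero {V : Type*} [Fintype V] {S : Matrix V V ℝ}
    (h : S.PosSemidef) {i : V} (hi : S i i = 0) (j : V) : S i j = 0 := by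
  by_contra hij
  -- With `S i i = 0`, this choice gives the quadratic form the value `-1`.
  have h1 := PosSemidef.quadratic_nonneg h i j (-(S j j + 1) / (2 * S i j)) 1
  rw [hi] at h1
  have h2 : 2 * (-(S j j + 1) / (2 * S i j)) * 1 * S i j = -(S j j + 1) := by field_simp
  rw [h2] at h1
  linarith

theorem nonneg_of_mem_closure_sufficientCone [Fintype V] {T : Edge G → ℝ}
    (hT : T ∈ closure (sufficientCone G)) (i : V) : 0 ≤ T (loop G i) := by
  obtain ⟨S, hS, rfl⟩ := exists_posSemidef_of_mem_closure hT
  exact (hS.diag_nonneg (i := i)).trans_eq (extends_symmRestrict hS.1 i i (Or.inl rfl))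

theorem exists_sub_single_mem_coneBoundary [Fintype V] [DecidableEq (Edge G)] {T : Edge G → ℝ}
    (hT : T ∈ closure (sufficientCone G)) (i : V) :
    ∃ s, 0 ≤ s ∧ T - Pi.single (loop G i) s ∈ coneBoundary G := by
  -- The lowered diagonal entry equals `-1`.
  have hy : T - Pi.single (loop G i) (T (loop G i) + 1) ∉ closure (sufficientCone G) := by
    intro h
    have := nonneg_of_mem_closure_sufficientCone h i
    simp at this
    linarith
  obtain ⟨_, ⟨a, b, ha, hb, hab, rfl⟩, hz⟩ := exists_mem_coneBoundary hT hy
  refine ⟨b * (T (loop G i) + 1),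
    mul_nonneg hb (by linarith [nonneg_of_mem_closure_sufficientCone hT i]), ?_⟩
  convert hz using 1
  obtain rfl : a = 1 - b := by linarith
  rw [← smul_eq_mul, Pi.single_smul]
  module

/-- The boundary points with vanishing apex entry are limits of the others. -/
theorem mem_closure_coneBoundary_suspension [Fintype V] [Nonempty V]
    (hu : u ∈ coneBoundary (suspension G)) :
    u ∈ closure {v ∈ coneBoundary (suspension G) | 0 < v (apexLoop G)} := by
  classical
  rcases (nonneg_of_mem_closure_sufficientCone hu.1 none : 0 ≤ u (apexLoop G)).eq_or_lt' with h0 | h0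
  swap
  · exact subset_closure ⟨hu, h0⟩
  have hapex : ∀ o, u (apex G o) = 0 := by
    obtain ⟨S, hS, hSu⟩ := exists_posSemidef_of_mem_closure hu.1
    have hext := extends_symmRestrict (G := suspension G) hS.1
    rw [hSu] at hext
    rintro (_ | j)
    · exact h0
    · rw [← PosSemidef.eq_zero_of_diag_eq_zero hS ((hext none none (Or.inl rfl)).trans h0) (some j)]
      exact (hext none (some j) (Or.inr trivial)).symm
  have hbase : u ∘ baseEdge G ∈ closure (sufficientCone G) :=
    map_mem_closure (f := fun v : Edge (suspension G) → ℝ => v ∘ baseEdge G) (by fun_prop) hu.1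
      fun v hv => comp_baseEdge_mem_sufficientCone hv
  obtain ⟨i⟩ := ‹Nonempty V›
  obtain ⟨s, hs, hz⟩ := exists_sub_single_mem_coneBoundary hbase i
  -- The correction `u_0i² / u_00` is then `s` for every `ε > 0`, so the Schur complement is the
  -- fixed boundary point found above. At `ε = 0` the path reaches `u`, whose apex row vanishes.
  let x : ℝ → Option V → ℝ := fun ε o => o.elim ε fun j => if j = i then √(ε * s) else 0
  let P : ℝ → Edge (suspension G) → ℝ := fun ε => join (x ε) (u ∘ baseEdge G)
  have hP0 : P 0 = u := by
    ext e
    induction e using position_cases with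
    | apex o => rcases o with _ | j <;> simp [P, x, hapex]
    | base e => simp [P]
  have hPcont : Continuous P := by
    refine continuous_pi fun e => ?_
    induction e using position_cases with
    | apex o =>
      simp only [P, join_apex, x]
      rcases o with _ | j
      · exact continuous_id
      · simp only [Option.elim]
        split_ifs <;> fun_prop
    | base e => simpa [P] using continuous_const
  have hPmem : ∀ ε > 0, P ε ∈ {v ∈ coneBoundary (suspension G) | 0 < v (apexLoop G)} := by
    intro ε hε
    have hpos : 0 < P ε (apexLoop G) := by simpa [P, x] using hε
    refine ⟨(mem_coneBoundary_suspension_iff hpos).2 ?_, hpos⟩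
    convert hz using 1
    ext ⟨e, he⟩
    induction e with
    | _ a b =>
      rw [schurComplement_mk]
      simp only [P, x, join_apexLoop, join_apexEdge, join_baseEdge, Option.elim, Pi.sub_apply,
        Function.comp_apply]
      congr 1
      by_cases h : a = i ∧ b = i
      · obtain ⟨rfl, rfl⟩ := h
        rw [show (⟨s(_, _), he⟩ : Edge G) = loop G _ from rfl, Pi.single_eq_same, if_pos rfl,
          Real.mul_self_sqrt (by positivity)]
        field_simp
      · rw [Pi.single_eq_of_ne]
        · have : (if a = i then √(ε * s) else 0) * (if b = i then √(ε * s) else 0) = 0 := by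
            grind
          rw [this, zero_div]
        · intro hne
          exact h (by simpa [loop] using congrArg Subtype.val hne)
  have hmem : (0 : ℝ) ∈ closure (Set.Ioi 0) := by simp
  rw [← hP0]
  exact map_mem_closure hPcont hmem hPmem

end Cone

end GaussianGraph

end

/-! ### Inverting `u_00`: divisibility, primality and numerators. -/

noncomputable section

section Away

variable {R : Type*} [CommRing R] [IsDomain R] {z : R} {A : Type*} [CommRing A]
  [Algebra R A] [IsLocalization.Away z A]

theorem IsLocalization.Away.algebraMap_injective_of_ne_zero (A : Type*) [CommRing A] [Algebra R A]
    [IsLocalization.Away z A] (hz : z ≠ 0) : Function.Injective (algebraMap R A) :=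
  IsLocalization.injective A (powers_le_nonZeroDivisors_of_noZeroDivisors hz)

/-- Clearing denominators gives `y * z ^ n = x * r`; as the prime `z` does not divide `x`, all of `z
^ n` divides `r` and cancels. -/
theorem IsLocalization.Away.algebraMap_dvd_iff (hz : Prime z) {x y : R} (hx : ¬z ∣ x) :
    algebraMap R A x ∣ algebraMap R A y ↔ x ∣ y := by
  refine ⟨fun ⟨a, ha⟩ => ?_, map_dvd _⟩
  obtain ⟨n, r, hr⟩ := IsLocalization.Away.surj z a
  have h1 : y * z ^ n = x * r := by
    apply algebraMap_injective_of_ne_zero A hz.ne_zero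
    rw [map_mul, map_mul, map_pow, ha, ← hr, mul_assoc]
  obtain ⟨r', rfl⟩ := hz.pow_dvd_of_dvd_mul_left n hx ⟨y, by rw [← h1, mul_comm]⟩
  exact ⟨r', mul_right_cancel₀ (pow_ne_zero n hz.ne_zero) (by rw [h1]; ring)⟩

theorem IsLocalization.Away.prime_algebraMap_iff (hz : Prime z) {x : R} (hx : ¬z ∣ x) :
    Prime (algebraMap R A x) ↔ Prime x := by
  have hinj := algebraMap_injective_of_ne_zero A hz.ne_zero
  have hx0 : x ≠ 0 := by
    rintro rfl
    exact hx (dvd_zero z)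
  have hunit : ∀ n, IsUnit (algebraMap R A z ^ n) := fun n =>
    (IsLocalization.Away.algebraMap_isUnit z).pow n
  have hu : IsUnit (algebraMap R A x) ↔ IsUnit x := by
    rw [isUnit_iff_dvd_one, isUnit_iff_dvd_one, ← map_one (algebraMap R A),
      algebraMap_dvd_iff hz hx]
  refine ⟨fun h => ⟨hx0, hu.not.1 h.not_isUnit, fun a b hab => ?_⟩,
    fun h => ⟨(map_ne_zero_iff _ hinj).2 hx0, hu.not.2 h.not_isUnit, fun a b hab => ?_⟩⟩
  · rw [← algebraMap_dvd_iff (A := A) hz hx, ← algebraMap_dvd_iff (A := A) hz hx]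
    exact h.dvd_or_dvd (by rw [← map_mul]; exact map_dvd _ hab)
  · obtain ⟨n, r, hr⟩ := IsLocalization.Away.surj z a
    obtain ⟨m, s, hs⟩ := IsLocalization.Away.surj z b
    rw [← (hunit n).dvd_mul_right, hr, ← (hunit m).dvd_mul_right (b := b), hs,
      algebraMap_dvd_iff hz hx, algebraMap_dvd_iff hz hx]
    refine h.dvd_or_dvd ((algebraMap_dvd_iff (A := A) hz hx).1 ?_)
    rw [map_mul, ← hr, ← hs]
    exact hab.trans ⟨algebraMap R A z ^ n * algebraMap R A z ^ m, by ring⟩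

/-- The numerator in lowest terms of an element of a localization away from a prime. -/
theorem IsLocalization.Away.associated_num [UniqueFactorizationMonoid R] {K : Type*} [Field K]
    [Algebra R K] [IsFractionRing R K] [Algebra A K] [IsScalarTower R A K] (hz : Prime z) (a : A) :
    Associated (algebraMap R A (IsFractionRing.num R (algebraMap A K a))) a ∧
      (z ∣ IsFractionRing.num R (algebraMap A K a) →
        ∃ d, IsUnit d ∧ algebraMap R A (IsFractionRing.num R (algebraMap A K a)) =
          a * algebraMap R A d) := by
  have hinj := algebraMap_injective_of_ne_zero A hz.ne_zero
  set N := IsFractionRing.num R (algebraMap A K a)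
  set D : R := (IsFractionRing.den R (algebraMap A K a) : R)
  have hrel : IsRelPrime N D := IsFractionRing.num_den_reduced R _
  obtain ⟨n, r, hr⟩ := IsLocalization.Away.surj z a
  have hND : algebraMap A K a * algebraMap R K D = algebraMap R K N :=
    IsFractionRing.num_mul_den_eq_num_iff_eq.2 rfl
  have h1 : N * z ^ n = D * r := by
    apply IsFractionRing.injective R K
    rw [map_mul, map_mul, ← hND, IsScalarTower.algebraMap_apply R A K r, ← hr, map_mul,
      IsScalarTower.algebraMap_apply R A K (z ^ n), map_pow (algebraMap R A)]
    ring
  -- Being coprime to `N`, the denominator divides a power of `z`; it is a unit as soon as `z`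
  -- divides `N`.
  obtain ⟨i, hi, hDi⟩ := (dvd_prime_pow hz n).1 (hrel.symm.dvd_of_dvd_mul_left ⟨r, h1⟩)
  have hDu : IsUnit (algebraMap R A D) := by
    refine ((hDi.map (algebraMap R A)).isUnit_iff).2 ?_
    rw [map_pow]
    exact (IsLocalization.Away.algebraMap_isUnit z).pow i
  have h2 : algebraMap R A N = a * algebraMap R A D := by
    have h3 : algebraMap R A z ^ n * algebraMap R A N =
        algebraMap R A z ^ n * (a * algebraMap R A D) := by
      rw [← map_pow, ← map_mul, mul_comm _ N, h1, map_mul, ← hr, map_pow]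
      ring
    exact ((IsLocalization.Away.algebraMap_isUnit z).pow n).mul_left_cancel h3
  refine ⟨?_, fun hzN => ⟨D, ?_, h2⟩⟩
  · rw [h2]
    exact associated_mul_unit_left _ _ hDu
  · have : i = 0 := by
      by_contra h
      exact hz.not_isUnit (hrel hzN ((dvd_pow_self z h).trans hDi.symm.dvd))
    rw [this, pow_zero] at hDi
    exact hDi.symm.isUnit isUnit_one

end Away

namespace GaussianGraph

open MvPolynomial

variable {V : Type*} (𝕜 : Type*) [RCLike 𝕜] (G : SimpleGraph V)

/-- The coordinate `u_00`. -/
abbrev apexVar : MvPolynomial (Edge (suspension G)) 𝕜 := X (apexLoop G)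

/-- The ring of polynomials in the `u_ij` and the inverse of `u_00`. -/
abbrev LaurentRing : Type _ := Localization.Away (apexVar 𝕜 G)

/-- The coordinates in `LaurentRing`. -/
def laurentVar (e : Edge (suspension G)) : LaurentRing 𝕜 G := algebraMap _ _ (X e : MvPolynomial _ 𝕜)

/-- The inverse of `u_00`. -/
def apexInv : LaurentRing 𝕜 G := IsLocalization.Away.invSelf (apexVar 𝕜 G)

variable {G}

/-- Evaluation of Laurent polynomials. -/
def laurentEval {B : Type*} [CommRing B] [Algebra 𝕜 B] (u : Edge (suspension G) → B)
    (hu : IsUnit (u (apexLoop G))) : LaurentRing 𝕜 G →ₐ[𝕜] B :=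
  IsLocalization.Away.liftAlgHom (apexVar 𝕜 G) (f := aeval u) (by rwa [aeval_X])

variable {𝕜}

theorem laurentEval_algebraMap {B : Type*} [CommRing B] [Algebra 𝕜 B] (u : Edge (suspension G) → B)
    (hu : IsUnit (u (apexLoop G))) (p : MvPolynomial (Edge (suspension G)) 𝕜) :
    laurentEval 𝕜 u hu (algebraMap _ _ p) = aeval u p :=
  IsLocalization.Away.lift_eq (apexVar 𝕜 G) (g := (aeval u).toRingHom)
    (show IsUnit (aeval u (apexVar 𝕜 G)) by rwa [aeval_X]) p

@[simp]
theorem laurentEval_laurentVar {B : Type*} [CommRing B] [Algebra 𝕜 B] (u : Edge (suspension G) → B)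
    (hu : IsUnit (u (apexLoop G))) (e : Edge (suspension G)) :
    laurentEval 𝕜 u hu (laurentVar 𝕜 G e) = u e := by
  rw [laurentVar, laurentEval_algebraMap, aeval_X]

theorem laurentVar_mul_apexInv : laurentVar 𝕜 G (apexLoop G) * apexInv 𝕜 G = 1 :=
  IsLocalization.Away.mul_invSelf _

theorem isUnit_laurentVar : IsUnit (laurentVar 𝕜 G (apexLoop G)) :=
  IsUnit.of_mul_eq_one _ laurentVar_mul_apexInv

theorem laurentEval_apexInv {B : Type*} [CommRing B] [Algebra 𝕜 B] (u : Edge (suspension G) → B)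
    (hu : IsUnit (u (apexLoop G))) {b : B} (hb : u (apexLoop G) * b = 1) :
    laurentEval 𝕜 u hu (apexInv 𝕜 G) = b := by
  have h := congrArg (laurentEval 𝕜 u hu) (laurentVar_mul_apexInv (𝕜 := 𝕜) (G := G))
  rw [map_mul, map_one, laurentEval_laurentVar, ← hb] at h
  exact hu.mul_left_cancel h

theorem laurent_algHom_ext {B : Type*} [CommRing B] [Algebra 𝕜 B] {f g : LaurentRing 𝕜 G →ₐ[𝕜] B}
    (h : ∀ e, f (laurentVar 𝕜 G e) = g (laurentVar 𝕜 G e)) : f = g := by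
  refine IsLocalization.algHom_ext (Submonoid.powers (apexVar 𝕜 G)) ?_
  exact MvPolynomial.algHom_ext h

variable (𝕜 G) in
/-- The substitution `u_ij ↦ u_ij + c u_0i u_0j / u_00`. -/
def shearHom (c : 𝕜) : LaurentRing 𝕜 G →ₐ[𝕜] LaurentRing 𝕜 G :=
  laurentEval 𝕜 (shear (c • apexInv 𝕜 G) (laurentVar 𝕜 G)) (by
    rw [shear_apexLoop]
    exact isUnit_laurentVar)

theorem shearHom_laurentVar (c : 𝕜) (e : Edge (suspension G)) :
    shearHom 𝕜 G c (laurentVar 𝕜 G e) = shear (c • apexInv 𝕜 G) (laurentVar 𝕜 G) e :=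
  laurentEval_laurentVar _ _ _

theorem shearHom_apexInv (c : 𝕜) : shearHom 𝕜 G c (apexInv 𝕜 G) = apexInv 𝕜 G :=
  laurentEval_apexInv _ _ (by rw [shear_apexLoop, laurentVar_mul_apexInv])

theorem shearHom_comp (c d : 𝕜) :
    (shearHom 𝕜 G c).comp (shearHom 𝕜 G d) = shearHom 𝕜 G (c + d) := by
  refine laurent_algHom_ext fun e => ?_
  rw [AlgHom.comp_apply, shearHom_laurentVar, shearHom_laurentVar, map_shear, map_smul,
    shearHom_apexInv]
  simp only [shearHom_laurentVar]
  change shear _ (shear _ _) e = _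
  rw [shear_shear, add_smul, add_comm]

theorem shearHom_zero : shearHom 𝕜 G 0 = AlgHom.id 𝕜 _ :=
  laurent_algHom_ext fun e => by simp [shearHom_laurentVar]

variable (𝕜 G) in
/-- The automorphism `u_ij ↦ u_ij - u_0i u_0j / u_00`. -/
def schurEquiv : LaurentRing 𝕜 G ≃ₐ[𝕜] LaurentRing 𝕜 G :=
  AlgEquiv.ofAlgHom (shearHom 𝕜 G (-1)) (shearHom 𝕜 G 1)
    (by rw [shearHom_comp, neg_add_cancel, shearHom_zero])
    (by rw [shearHom_comp, add_neg_cancel, shearHom_zero])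

/-- Translates the ring automorphism into the shear of points that inverts the Schur complement. -/
theorem laurentEval_schurEquiv_symm {K : Type*} [Field K] [Algebra 𝕜 K]
    (u : Edge (suspension G) → K) (hu : u (apexLoop G) ≠ 0) (a : LaurentRing 𝕜 G) :
    laurentEval 𝕜 u hu.isUnit ((schurEquiv 𝕜 G).symm a) =
      laurentEval 𝕜 (shear (u (apexLoop G))⁻¹ u) (by rw [shear_apexLoop]; exact hu.isUnit) a := by
  change ((laurentEval 𝕜 u hu.isUnit).comp (shearHom 𝕜 G 1)) a = _
  congr 1
  refine laurent_algHom_ext fun e => ?_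
  rw [AlgHom.comp_apply, shearHom_laurentVar, map_shear, one_smul,
    laurentEval_apexInv _ _ (mul_inv_cancel₀ hu)]
  simp

/-- A polynomial in the base coordinates. -/
def baseRename : MvPolynomial (Edge G) 𝕜 →ₐ[𝕜] MvPolynomial (Edge (suspension G)) 𝕜 :=
  rename (baseEdge G)

theorem isUnit_coord : IsUnit (coord 𝕜 G (apexLoop G)) :=
  IsUnit.mk0 _ (by
    rw [coord, Ne, map_eq_zero_iff _ (IsFractionRing.injective _ _)]
    exact X_ne_zero _)

/-- A Laurent polynomial as a rational function. -/
instance : Algebra (LaurentRing 𝕜 G) (SuspensionField 𝕜 G) :=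
  (laurentEval 𝕜 (coord 𝕜 G) isUnit_coord).toRingHom.toAlgebra

theorem algebraMap_laurentRing_suspensionField (a : LaurentRing 𝕜 G) :
    algebraMap (LaurentRing 𝕜 G) (SuspensionField 𝕜 G) a =
      laurentEval 𝕜 (coord 𝕜 G) isUnit_coord a := rfl

theorem aeval_coord (p : MvPolynomial (Edge (suspension G)) 𝕜) :
    aeval (coord 𝕜 G) p = algebraMap _ (SuspensionField 𝕜 G) p := by
  change aeval (fun e => algebraMap _ (SuspensionField 𝕜 G) (X e)) p = _
  rw [← aeval_X_left_apply p, ← aeval_algebraMap_apply, aeval_X_left_apply p]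
  rfl

instance : IsScalarTower (MvPolynomial (Edge (suspension G)) 𝕜) (LaurentRing 𝕜 G)
    (SuspensionField 𝕜 G) :=
  .of_algebraMap_eq fun p => by
    rw [algebraMap_laurentRing_suspensionField, laurentEval_algebraMap, aeval_coord]

/-- The substitution is an automorphism of the Laurent ring restricted to polynomials in the base
coordinates, so factorizations can be transported. -/
theorem schurSubst_eq (p : MvPolynomial (Edge G) 𝕜) :
    schurSubst 𝕜 G p = algebraMap (LaurentRing 𝕜 G) (SuspensionField 𝕜 G)
      (schurEquiv 𝕜 G (algebraMap _ _ (baseRename p))) := by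
  change schurSubst 𝕜 G p = ((laurentEval 𝕜 (coord 𝕜 G) isUnit_coord).comp
    ((shearHom 𝕜 G (-1)).comp
      ((Algebra.algHom 𝕜 _ (LaurentRing 𝕜 G)).comp (rename (baseEdge G))))) p
  congr 1
  refine MvPolynomial.algHom_ext fun e => ?_
  have h1 : coord 𝕜 G (apexLoop G) * (coord 𝕜 G (apexLoop G))⁻¹ = 1 :=
    mul_inv_cancel₀ isUnit_coord.ne_zero
  rw [AlgHom.comp_apply, AlgHom.comp_apply, AlgHom.comp_apply, rename_X]
  change _ = laurentEval 𝕜 (coord 𝕜 G) isUnit_coord (shearHom 𝕜 G (-1) (laurentVar 𝕜 G _))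
  rw [shearHom_laurentVar, map_shear, map_smul, laurentEval_apexInv _ _ h1, shear_baseEdge,
    schurSubst, aeval_X]
  simp only [laurentEval_laurentVar, neg_smul, one_smul]
  ring

theorem prime_apexVar : Prime (apexVar 𝕜 G) := X_prime

theorem aeval_join_X_baseRename (x : Option V → MvPolynomial (Edge G) 𝕜)
    (p : MvPolynomial (Edge G) 𝕜) : aeval (join x X) (baseRename p) = p := by
  rw [baseRename, aeval_rename]
  conv_rhs => rw [← aeval_X_left_apply p]
  congr 2
  ext1 e
  simp

theorem not_apexVar_dvd_baseRename {p : MvPolynomial (Edge G) 𝕜} (hp : p ≠ 0) :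
    ¬apexVar 𝕜 G ∣ baseRename p := by
  intro h
  have h1 := map_dvd (aeval (join (fun _ => 0) X) :
    MvPolynomial (Edge (suspension G)) 𝕜 →ₐ[𝕜] MvPolynomial (Edge G) 𝕜) h
  rw [aeval_X, join_apexLoop, zero_dvd_iff, aeval_join_X_baseRename] at h1
  exact hp h1

theorem baseRename_dvd_iff {p q : MvPolynomial (Edge G) 𝕜} :
    baseRename p ∣ baseRename q ↔ p ∣ q := by
  refine ⟨fun h => ?_, fun h => map_dvd _ h⟩
  have h1 := map_dvd (aeval (join (fun _ => 0) X) :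
    MvPolynomial (Edge (suspension G)) 𝕜 →ₐ[𝕜] MvPolynomial (Edge G) 𝕜) h
  rwa [aeval_join_X_baseRename, aeval_join_X_baseRename] at h1

variable (𝕜 G) in
/-- Polynomials on the suspension graph as polynomials in the apex row over the polynomials
on the base. -/
def apexPolynomialEquiv : MvPolynomial (Edge (suspension G)) 𝕜 ≃ₐ[𝕜]
    MvPolynomial (Option V) (MvPolynomial (Edge G) 𝕜) :=
  (renameEquiv 𝕜 (positionEquiv G).symm).trans (sumAlgEquiv 𝕜 _ _)

theorem apexPolynomialEquiv_X (e : Edge (suspension G)) :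
    apexPolynomialEquiv 𝕜 G (X e) = join X (fun e => C (X e)) e := by
  simp only [apexPolynomialEquiv, AlgEquiv.trans_apply, renameEquiv_apply, rename_X, join,
    Function.comp_apply]
  rcases (positionEquiv G).symm e with o | e <;> simp

theorem apexPolynomialEquiv_baseRename (p : MvPolynomial (Edge G) 𝕜) :
    apexPolynomialEquiv 𝕜 G (baseRename p) = C p := by
  change ((apexPolynomialEquiv 𝕜 G).toAlgHom.comp (rename (baseEdge G))) p =
    Algebra.algHom 𝕜 (MvPolynomial (Edge G) 𝕜) (MvPolynomial (Option V) _) p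
  congr 1
  refine MvPolynomial.algHom_ext fun e => ?_
  rw [AlgHom.comp_apply, rename_X]
  change apexPolynomialEquiv 𝕜 G (X _) = C (X e)
  rw [apexPolynomialEquiv_X, join_baseEdge]

theorem eval_map_apexPolynomialEquiv (x : Option V → 𝕜) (T : Edge G → 𝕜)
    (r : MvPolynomial (Edge (suspension G)) 𝕜) :
    eval x (map ((aeval T : MvPolynomial (Edge G) 𝕜 →ₐ[𝕜] 𝕜) : MvPolynomial (Edge G) 𝕜 →+* 𝕜) (apexPolynomialEquiv 𝕜 G r)) =
      aeval (join x T) r := by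
  induction r using MvPolynomial.induction_on with
  | C a =>
    rw [← algebraMap_eq, AlgEquiv.commutes, AlgHom.commutes, IsScalarTower.algebraMap_apply 𝕜
      (MvPolynomial (Edge G) 𝕜), algebraMap_eq, map_C, eval_C]
    simp
  | add p q hp hq => simp only [map_add, hp, hq]
  | mul_X p e hp =>
    simp only [map_mul, hp, aeval_X, apexPolynomialEquiv_X]
    congr 1
    induction e using position_cases <;> simp

theorem prime_baseRename {p : MvPolynomial (Edge G) 𝕜} (hp : Prime p) : Prime (baseRename p) := by
  rw [← MulEquiv.prime_iff (apexPolynomialEquiv 𝕜 G), apexPolynomialEquiv_baseRename,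
    prime_C_iff]
  exact hp

theorem associated_algebraMap_schurNumerator (p : MvPolynomial (Edge G) 𝕜) :
    Associated (algebraMap _ (LaurentRing 𝕜 G) (schurNumerator 𝕜 G p))
      (schurEquiv 𝕜 G (algebraMap _ _ (baseRename p))) := by
  rw [schurNumerator, schurSubst_eq]
  exact (IsLocalization.Away.associated_num prime_apexVar _).1

/-- If `u_00` divided the numerator, the denominator would be a unit. Setting all `u_0i = 0` while
keeping `u_00` removes the correction terms and leaves `p` in the base coordinates times a unit,
which `u_00` does not divide. -/
theorem not_apexVar_dvd_schurNumerator {p : MvPolynomial (Edge G) 𝕜} (hp : p ≠ 0) :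
    ¬apexVar 𝕜 G ∣ schurNumerator 𝕜 G p := by
  intro h
  have h0 := h
  rw [schurNumerator, schurSubst_eq] at h
  obtain ⟨d, hd, hN⟩ := (IsLocalization.Away.associated_num prime_apexVar _).2 h
  rw [← schurSubst_eq, ← schurNumerator] at hN
  let x : Option V → MvPolynomial (Edge (suspension G)) 𝕜 :=
    fun o => o.elim (apexVar 𝕜 G) fun _ => 0
  let κ₀ : MvPolynomial (Edge (suspension G)) 𝕜 →ₐ[𝕜] MvPolynomial (Edge (suspension G)) 𝕜 :=
    aeval (join x fun e => X (baseEdge G e))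
  let v : Edge (suspension G) → LaurentRing 𝕜 G :=
    fun e => algebraMap _ _ (join x (fun e => X (baseEdge G e)) e)
  have hv : IsUnit (v (apexLoop G)) := by
    simp only [v, join_apexLoop]
    exact isUnit_laurentVar
  let κ := laurentEval 𝕜 v hv
  have hκ : ∀ f, κ (algebraMap _ _ f) = algebraMap _ _ (κ₀ f) := fun f => by
    simp only [κ, κ₀, laurentEval_algebraMap, v]
    exact aeval_algebraMap_apply _ _ f
  have hκE : κ (schurEquiv 𝕜 G (algebraMap _ _ (baseRename p))) =
      algebraMap _ _ (baseRename p) := by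
    change (κ.comp ((shearHom 𝕜 G (-1)).comp
      ((Algebra.algHom 𝕜 _ (LaurentRing 𝕜 G)).comp (rename (baseEdge G))))) p =
      ((Algebra.algHom 𝕜 _ (LaurentRing 𝕜 G)).comp (rename (baseEdge G))) p
    congr 1
    refine MvPolynomial.algHom_ext fun e => ?_
    rw [AlgHom.comp_apply, AlgHom.comp_apply, AlgHom.comp_apply, rename_X]
    change κ (shearHom 𝕜 G (-1) (laurentVar 𝕜 G _)) = laurentVar 𝕜 G _
    rw [shearHom_laurentVar, map_shear, shear_baseEdge]
    have hzero : (e.1.map fun i => κ (laurentVar 𝕜 G (apexEdge G i))).mul = 0 := by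
      simp only [κ, laurentEval_laurentVar, v, join_apexEdge, x, Option.elim, map_zero]
      obtain ⟨e, he⟩ := e
      induction e with
      | _ i j => simp
    rw [hzero, mul_zero, add_zero]
    simp only [κ, laurentEval_laurentVar, v, join_baseEdge]
    rfl
  have h1 : κ₀ (schurNumerator 𝕜 G p) = baseRename p * κ₀ d := by
    apply IsLocalization.Away.algebraMap_injective_of_ne_zero (LaurentRing 𝕜 G)
      prime_apexVar.ne_zero
    rw [← hκ, hN, map_mul, hκE, map_mul, hκ]
  have h2 : apexVar 𝕜 G ∣ baseRename p * κ₀ d := by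
    rw [← h1]
    have := map_dvd κ₀ h0
    simpa [κ₀, x] using this
  exact not_apexVar_dvd_baseRename hp ((hd.map κ₀).dvd_mul_right.1 h2)

theorem schurNumerator_dvd_iff {p : MvPolynomial (Edge G) 𝕜} (hp : p ≠ 0)
    {f : MvPolynomial (Edge (suspension G)) 𝕜} :
    schurNumerator 𝕜 G p ∣ f ↔ algebraMap _ (LaurentRing 𝕜 G) (baseRename p) ∣
      (schurEquiv 𝕜 G).symm (algebraMap _ _ f) := by
  rw [← IsLocalization.Away.algebraMap_dvd_iff (A := LaurentRing 𝕜 G) prime_apexVar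
    (not_apexVar_dvd_schurNumerator hp),
    (associated_algebraMap_schurNumerator p).dvd_iff_dvd_left,
    ← map_dvd_iff (schurEquiv 𝕜 G).symm, AlgEquiv.symm_apply_apply]

theorem schurNumerator_dvd_schurNumerator_iff {p q : MvPolynomial (Edge G) 𝕜} (hp : p ≠ 0) :
    schurNumerator 𝕜 G p ∣ schurNumerator 𝕜 G q ↔ p ∣ q := by
  have h : Associated ((schurEquiv 𝕜 G).symm (algebraMap _ _ (schurNumerator 𝕜 G q)))
      (algebraMap _ _ (baseRename q)) := by
    have := (associated_algebraMap_schurNumerator q).map (schurEquiv 𝕜 G).symm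
    rwa [AlgEquiv.symm_apply_apply] at this
  rw [schurNumerator_dvd_iff hp, h.dvd_iff_dvd_right,
    IsLocalization.Away.algebraMap_dvd_iff prime_apexVar (not_apexVar_dvd_baseRename hp),
    baseRename_dvd_iff]

theorem prime_schurNumerator {p : MvPolynomial (Edge G) 𝕜} (hp : Prime p) :
    Prime (schurNumerator 𝕜 G p) := by
  rw [← IsLocalization.Away.prime_algebraMap_iff (A := LaurentRing 𝕜 G) prime_apexVar
    (not_apexVar_dvd_schurNumerator hp.ne_zero),
    (associated_algebraMap_schurNumerator p).prime_iff, MulEquiv.prime_iff,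
    IsLocalization.Away.prime_algebraMap_iff prime_apexVar (not_apexVar_dvd_baseRename hp.ne_zero)]
  exact prime_baseRename hp

/-- `P` stays prime in the Laurent ring, where up to units the numerator is a ring homomorphism
applied to `H`; so `P` divides the image of some prime factor of `H`. -/
theorem exists_dvd_schurNumerator_of_prime {P : MvPolynomial (Edge (suspension G)) 𝕜}
    (hP : Prime P) {H : MvPolynomial (Edge G) 𝕜} (hH : H ≠ 0) (hPH : P ∣ schurNumerator 𝕜 G H) :
    ∃ p, Prime p ∧ p ∣ H ∧ P ∣ schurNumerator 𝕜 G p := by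
  have hzP : ∀ {q}, q ≠ 0 → P ∣ schurNumerator 𝕜 G q → ¬apexVar 𝕜 G ∣ P := fun hq h h' =>
    not_apexVar_dvd_schurNumerator hq (h'.trans h)
  have hz := hzP hH hPH
  have hA : Prime (algebraMap _ (LaurentRing 𝕜 G) P) :=
    (IsLocalization.Away.prime_algebraMap_iff prime_apexVar hz).2 hP
  have hdvd : ∀ q : MvPolynomial (Edge G) 𝕜, P ∣ schurNumerator 𝕜 G q ↔
      algebraMap _ (LaurentRing 𝕜 G) P ∣ schurEquiv 𝕜 G (algebraMap _ _ (baseRename q)) := by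
    intro q
    rw [← IsLocalization.Away.algebraMap_dvd_iff (A := LaurentRing 𝕜 G) prime_apexVar hz,
      (associated_algebraMap_schurNumerator q).dvd_iff_dvd_right]
  let φ : MvPolynomial (Edge G) 𝕜 →ₐ[𝕜] LaurentRing 𝕜 G :=
    (schurEquiv 𝕜 G).toAlgHom.comp
      ((Algebra.algHom 𝕜 _ (LaurentRing 𝕜 G)).comp baseRename)
  obtain ⟨s, hs, hsH⟩ := UniqueFactorizationMonoid.exists_prime_factors H hH
  have h1 : algebraMap _ (LaurentRing 𝕜 G) P ∣ (s.map φ).prod := by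
    rw [Multiset.prod_hom, ((hsH.map φ).dvd_iff_dvd_right)]
    exact (hdvd H).1 hPH
  obtain ⟨p, hp, hPp⟩ := hA.exists_mem_multiset_map_dvd h1
  exact ⟨p, hs p hp, (Multiset.dvd_prod hp).trans hsH.dvd, (hdvd p).2 hPp⟩

end GaussianGraph

end

/-! ### The vanishing ideal for the suspension graph, and the conclusion. -/

noncomputable section

namespace GaussianGraph

open MvPolynomial

variable {V : Type*} {𝕜 : Type*} [RCLike 𝕜] {G : SimpleGraph V}

theorem castPoint_shear_join (x : Option V → ℝ) (T : Edge G → ℝ) :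
    castPoint 𝕜 (shear (x none)⁻¹ (join x T)) =
      shear (castPoint 𝕜 x none)⁻¹ (join (castPoint 𝕜 x) (castPoint 𝕜 T)) := by
  ext e
  have h := map_shear (algebraMap ℝ 𝕜) (x none)⁻¹ (join x T) e
  rw [map_inv₀] at h
  refine h.trans ?_
  congr 1
  ext e
  induction e using position_cases <;> simp

/-- Boundary points with `u_00 > 0` are parametrized by `T` and the apex row; the others are limits
of these, and `f` is continuous. -/
theorem mem_vanishingIdeal_suspension_iff [Finite V] [Nonempty V]
    {f : MvPolynomial (Edge (suspension G)) 𝕜} :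
    f ∈ vanishingIdeal 𝕜 (castPoint 𝕜 '' coneBoundary (suspension G)) ↔
      ∀ T ∈ coneBoundary G, ∀ x : Option V → ℝ, 0 < x none →
        aeval (castPoint 𝕜 (shear (x none)⁻¹ (join x T))) f = 0 := by
  have := Fintype.ofFinite V
  constructor
  · intro h T hT x hx
    refine h _ ⟨_, ?_, rfl⟩
    rw [mem_coneBoundary_suspension_iff (by simpa using hx), schurComplement_shear_join]
    exact hT
  · rintro h _ ⟨u, hu, rfl⟩
    have hcl : IsClosed {v : Edge (suspension G) → ℝ | aeval (castPoint 𝕜 v) f = 0} :=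
      isClosed_eq (MvPolynomial.continuous_aeval_castPoint f) continuous_const
    refine closure_minimal (fun v hv => ?_) hcl (mem_closure_coneBoundary_suspension hu)
    have h1 := h _ ((mem_coneBoundary_suspension_iff hv.2).1 hv.1) (v ∘ apex G) hv.2
    have h2 := shear_join_schurComplement v
    rw [← h2]
    exact h1

/-- A polynomial in the apex row that vanishes whenever all its variables are positive reals is
zero. -/
theorem forall_aeval_join_eq_zero_iff [Finite V] {T : Edge G → 𝕜}
    {r : MvPolynomial (Edge (suspension G)) 𝕜} :
    (∀ x : Option V → ℝ, 0 < x none → aeval (join (castPoint 𝕜 x) T) r = 0) ↔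
      ∀ m, aeval T (coeff m (apexPolynomialEquiv 𝕜 G r)) = 0 := by
  simp only [← eval_map_apexPolynomialEquiv]
  have h0 : (∀ m, aeval T (coeff m (apexPolynomialEquiv 𝕜 G r)) = 0) ↔
      map ((aeval T : MvPolynomial (Edge G) 𝕜 →ₐ[𝕜] 𝕜) : MvPolynomial (Edge G) 𝕜 →+* 𝕜)
        (apexPolynomialEquiv 𝕜 G r) = 0 := by
    rw [MvPolynomial.ext_iff]
    simp [coeff_map]
  rw [h0]
  refine ⟨fun h => ?_, fun h x _ => by rw [h, map_zero]⟩
  refine funext_set (fun _ => (fun a : ℝ => (a : 𝕜)) '' Set.Ioi 0)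
    (fun _ => (Set.Ioi_infinite 0).image RCLike.ofReal_injective.injOn) fun z hz => ?_
  choose y hy hyz using fun o => hz o (Set.mem_univ o)
  obtain rfl : castPoint 𝕜 y = z := _root_.funext hyz
  rw [h y (hy none), map_zero]

theorem mem_vanishingIdeal_suspension_iff_dvd [Finite V] [Nonempty V]
    {H : MvPolynomial (Edge G) 𝕜} (hH : IsDefiningPolynomial 𝕜 G H)
    {f : MvPolynomial (Edge (suspension G)) 𝕜} :
    f ∈ vanishingIdeal 𝕜 (castPoint 𝕜 '' coneBoundary (suspension G)) ↔
      schurNumerator 𝕜 G H ∣ f := by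
  have hI : ∀ g, H ∣ g ↔ ∀ T ∈ coneBoundary G, aeval (castPoint 𝕜 T) g = 0 := fun g => by
    rw [← Ideal.mem_span_singleton, ← hH.2, mem_vanishingIdeal_iff, Set.forall_mem_image]
  -- `r` is `f` in the coordinates of apex row and Schur complement, with the powers of `u_00`
  -- cleared. Both sides of the claim amount to `H` dividing every coefficient of `r` in the apex
  -- variables.
  obtain ⟨n, r, hr⟩ := IsLocalization.Away.surj (apexVar 𝕜 G)
    ((schurEquiv 𝕜 G).symm (algebraMap _ _ f))
  have hval : ∀ (T : Edge G → ℝ) (x : Option V → ℝ), 0 < x none →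
      (aeval (join (castPoint 𝕜 x) (castPoint 𝕜 T)) r = 0 ↔
        aeval (castPoint 𝕜 (shear (x none)⁻¹ (join x T))) f = 0) := by
    intro T x hx
    have hx0 : (castPoint 𝕜 x none) ≠ 0 := RCLike.ofReal_ne_zero.2 hx.ne'
    have hu : join (castPoint 𝕜 x) (castPoint 𝕜 T) (apexLoop G) ≠ 0 := by
      rwa [join_apexLoop]
    have h1 := congrArg (laurentEval 𝕜 _ hu.isUnit) hr
    rw [map_mul, map_pow, laurentEval_schurEquiv_symm _ hu, laurentEval_algebraMap,
      laurentEval_algebraMap, laurentEval_algebraMap, aeval_X] at h1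
    rw [← h1, mul_eq_zero, or_iff_left (pow_ne_zero n hu), castPoint_shear_join, join_apexLoop]
  rw [mem_vanishingIdeal_suspension_iff, schurNumerator_dvd_iff hH.1,
    ← ((IsLocalization.Away.algebraMap_isUnit (S := LaurentRing 𝕜 G) (apexVar 𝕜 G)).pow
      n).dvd_mul_right, hr,
    IsLocalization.Away.algebraMap_dvd_iff prime_apexVar (not_apexVar_dvd_baseRename hH.1),
    ← map_dvd_iff (apexPolynomialEquiv 𝕜 G), apexPolynomialEquiv_baseRename, C_dvd_iff_dvd_coeff]
  simp only [hI]
  exact ⟨fun h m T hT => forall_aeval_join_eq_zero_iff.1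
      (fun x hx => (hval T x hx).2 (h T hT x hx)) m,
    fun h T hT x hx => (hval T x hx).1
      (forall_aeval_join_eq_zero_iff.2 (fun m => h m T hT) x hx)⟩

theorem isDefiningPolynomial_schurNumerator [Finite V] [Nonempty V]
    {H : MvPolynomial (Edge G) 𝕜} (hH : IsDefiningPolynomial 𝕜 G H) :
    IsDefiningPolynomial 𝕜 (suspension G) (schurNumerator 𝕜 G H) := by
  refine ⟨fun h => not_apexVar_dvd_schurNumerator hH.1 (h ▸ dvd_zero _), Ideal.ext fun f => ?_⟩
  rw [Ideal.mem_span_singleton]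
  exact mem_vanishingIdeal_suspension_iff_dvd hH

end GaussianGraph

end

theorem proposition4p10 (𝕜 : Type*) [RCLike 𝕜] {V : Type*} [Finite V] [Nonempty V]
    (G : SimpleGraph V) :
    (∃ H : MvPolynomial (GaussianGraph.Edge G) 𝕜, GaussianGraph.IsDefiningPolynomial 𝕜 G H) ∧
    ∀ H : MvPolynomial (GaussianGraph.Edge G) 𝕜, GaussianGraph.IsDefiningPolynomial 𝕜 G H →
      GaussianGraph.IsDefiningPolynomial 𝕜 (GaussianGraph.suspension G)
        (GaussianGraph.schurNumerator 𝕜 G H) ∧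
      (∀ p : MvPolynomial (GaussianGraph.Edge G) 𝕜, Irreducible p → p ∣ H →
        Irreducible (GaussianGraph.schurNumerator 𝕜 G p) ∧
        GaussianGraph.schurNumerator 𝕜 G p ∣ GaussianGraph.schurNumerator 𝕜 G H) ∧
      (∀ P : MvPolynomial (GaussianGraph.Edge (GaussianGraph.suspension G)) 𝕜,
        Irreducible P → P ∣ GaussianGraph.schurNumerator 𝕜 G H →
        ∃ p : MvPolynomial (GaussianGraph.Edge G) 𝕜, Irreducible p ∧ p ∣ H ∧
          Associated P (GaussianGraph.schurNumerator 𝕜 G p) ∧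
          ∀ q : MvPolynomial (GaussianGraph.Edge G) 𝕜, Irreducible q → q ∣ H →
            Associated P (GaussianGraph.schurNumerator 𝕜 G q) → Associated q p) := by
  refine ⟨GaussianGraph.exists_isDefiningPolynomial 𝕜 G, fun H hH =>
    ⟨GaussianGraph.isDefiningPolynomial_schurNumerator hH, fun p hp hpH =>
      ⟨(GaussianGraph.prime_schurNumerator hp.prime).irreducible,
        (GaussianGraph.schurNumerator_dvd_schurNumerator_iff hp.ne_zero).2 hpH⟩,
      fun P hP hPH => ?_⟩⟩
  obtain ⟨p, hp, hpH, hPp⟩ :=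
    GaussianGraph.exists_dvd_schurNumerator_of_prime hP.prime hH.1 hPH
  have hass := hP.associated_of_dvd (GaussianGraph.prime_schurNumerator hp).irreducible hPp
  refine ⟨p, hp.irreducible, hpH, hass, fun q hq _ hPq => ?_⟩
  -- Numerators reflect divisibility, hence uniqueness of the factor.
  exact hq.associated_of_dvd hp.irreducible
    ((GaussianGraph.schurNumerator_dvd_schurNumerator_iff hq.ne_zero).1
      (hPq.symm.trans hass).dvd)
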